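/- Let $\Lambda$ be the ring of symmetric functions over $\mathbb{Z}$ in countably many variables $x_1,x_2,\dots$ (invariant formal power series of bounded degree), let $h_r\in\Lambda$ be the complete homogeneous symmetric functions ($h_0=1$, $h_r=0$ for $r<0$), and let $\mathcal{P}$ be the set of all partitions. For $\lambda\in\mathcal{P}$ with $\ell$ nonzero parts let $\mathtt{s}^{\mathfrak{gl}}_\lambda=\det\big(h_{\lambda_i-i+j}\big)_{1\le i,j\le \ell}$ be the Schur function, and let $$\mathtt{s}^{\mathfrak{so}}_\lambda=\det\big(h_{\lambda_i-i+j}-h_{\lambda_i-i-j}\big)_{1\le i,j\le \ell},\qquad \mathtt{s}^{\mathfrak{sp}}_\lambda=\det\big(a_{ij}\big)_{1\le i,j\le \ell},\quad a_{i1}=h_{\lambda_i-i+1},\quad a_{ij}=h_{\lambda_i-i+j}+h_{\lambda_i-i-j+2}\ (j\ge 2),$$ be the universal orthogonal and symplectic characters of Koike and Terada. Let $c^{\nu}_{\lambda,\gamma}$ be the Littlewood--Richardson coefficients, $\mathtt{s}^{\mathfrak{gl}}_\lambda\mathtt{s}^{\mathfrak{gl}}_\gamma=\sum_\nu c^\nu_{\lambda,\gamma}\mathtt{s}^{\mathfrak{gl}}_\nu$.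 Let $\mathcal{P}^{(2)}$ (resp. $\mathcal{P}^{(1,1)}$) be the set of partitions all of whose rows (resp. columns) have even length, and let $\mathcal{P}^{(2)}(2k)$, $\mathcal{P}^{(1,1)}(2k)$ be their subsets of partitions of size $2k$. For $k\in\mathbb{N}$ and $\lambda\in\mathcal{P}$ put $$m^{\mathfrak{so}}_{k,\lambda}=\sum_{\nu\in\mathcal{P}^{(1,1)}(2k)}\ \sum_{\gamma\in\mathcal{P}^{(2)}}c^\nu_{\lambda,\gamma},\qquad m^{\mathfrak{sp}}_{k,\lambda}=\sum_{\nu\in\mathcal{P}^{(2)}(2k)}\ \sum_{\gamma\in\mathcal{P}^{(1,1)}}c^\nu_{\lambda,\gamma}.$$ Then, for each $k$, only finitely many triples $(\lambda,\nu,\gamma)$ contribute a nonzero term to these sums (so that the sums below over $\lambda$ are finite for each $k$), the infinite products below converge coefficientwise to elements of $\Lambda[[q]]$ (the universal graded characters $\mathrm{char}_q(\mathtt{S}(\mathfrak{so}))$ and $\mathrm{char}_q(\mathtt{S}(\mathfrak{sp}))$), and in $\Lambda[[q]]$ $$\prod_{i<j}\frac{1}{1-q x_i x_j}=\sum_{k\ge0}\sum_{\lambda\in\mathcal{P}}m^{\mathfrak{so}}_{k,\lambda}\,\mathtt{s}^{\mathfrak{so}}_\lambda\,q^k,\qquad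 \prod_{i\le j}\frac{1}{1-q x_i x_j}=\sum_{k\ge0}\sum_{\lambda\in\mathcal{P}}m^{\mathfrak{sp}}_{k,\lambda}\,\mathtt{s}^{\mathfrak{sp}}_\lambda\,q^k.$$ -/

import Mathlib

open scoped MvPowerSeries.WithPiTopology PowerSeries.WithPiTopology

namespace UniversalCharacters

/-- The ring `Λ` of symmetric functions over `ℤ` in countably many variables `x_0, x_1, x_2, …`:
the formal power series of bounded degree that are invariant under all permutations of the
variables. -/
def Lam : Subring (MvPowerSeries ℕ ℤ) where
  carrier := {f | (∃ d : ℕ, ∀ m : ℕ →₀ ℕ, d < m.degree → MvPowerSeries.coeff m f = 0) ∧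
    ∀ σ : Equiv.Perm ℕ, MvPowerSeries.renameEquiv ℤ σ f = f}
  mul_mem' := by
    rintro f g ⟨⟨d, hd⟩, hf⟩ ⟨⟨e, he⟩, hg⟩
    refine ⟨⟨d + e, fun m hm => ?_⟩, fun σ => by rw [map_mul, hf, hg]⟩
    classical
    rw [MvPowerSeries.coeff_mul]
    refine Finset.sum_eq_zero fun p hp => ?_
    replace hp : p.1 + p.2 = m := Finset.HasAntidiagonal.mem_antidiagonal.mp hp
    have h : p.1.degree + p.2.degree = m.degree := by rw [← hp, map_add]
    by_cases h1 : d < p.1.degree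
    · rw [hd _ h1, zero_mul]
    · rw [he p.2 (by omega), mul_zero]
  one_mem' := by
    classical
    refine ⟨⟨0, fun m hm => ?_⟩, fun σ => map_one _⟩
    rw [MvPowerSeries.coeff_one, if_neg]
    rintro rfl
    simp at hm
  add_mem' := by
    rintro f g ⟨⟨d, hd⟩, hf⟩ ⟨⟨e, he⟩, hg⟩
    refine ⟨⟨d + e, fun m hm => ?_⟩, fun σ => by rw [map_add, hf, hg]⟩
    rw [map_add, hd m (by omega), he m (by omega), add_zero]
  zero_mem' := ⟨⟨0, fun m _ => by simp⟩, fun σ => map_zero _⟩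
  neg_mem' := by
    rintro f ⟨⟨d, hd⟩, hf⟩
    refine ⟨⟨d, fun m hm => ?_⟩, fun σ => by rw [map_neg, hf]⟩
    rw [map_neg, hd m hm, neg_zero]

/-- The complete homogeneous symmetric function `h_r`, the sum of all monomials of degree `r`
(so `h_0 = 1`, and `h_r = 0` for `r < 0`). -/
noncomputable def h (r : ℤ) : Lam :=
  ⟨fun m : ℕ →₀ ℕ => if (m.degree : ℤ) = r then 1 else 0, by
    constructor
    · refine ⟨r.toNat, fun m hm => ?_⟩
      change (if (m.degree : ℤ) = r then (1 : ℤ) else 0) = 0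
      rw [if_neg]
      omega
    · intro σ
      ext m
      have key : ∀ n : ℕ →₀ ℕ, (Finsupp.embDomain σ.toEmbedding n).degree = n.degree := by
        intro n
        exact Finsupp.sum_embDomain (v := n) (f := σ.toEmbedding) (g := fun _ x => x)
      have hm : m = Finsupp.embDomain σ.toEmbedding (Finsupp.embDomain σ.symm.toEmbedding m) := by
        ext i
        have h1 := Finsupp.embDomain_apply_self σ.toEmbedding
          (Finsupp.embDomain σ.symm.toEmbedding m) (σ.symm i)
        have h2 := Finsupp.embDomain_apply_self σ.symm.toEmbedding m i
        simp only [Equiv.coe_toEmbedding, Equiv.apply_symm_apply] at h1 h2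
        rw [h1, h2]
      rw [hm]
      generalize Finsupp.embDomain σ.symm.toEmbedding m = n
      have h3 := MvPowerSeries.coeff_embDomain_rename (R := ℤ) σ.toEmbedding
        (fun m : ℕ →₀ ℕ => if (m.degree : ℤ) = r then 1 else 0) n
      refine Eq.trans h3 ?_
      change (if (n.degree : ℤ) = r then (1 : ℤ) else 0) =
        (if ((Finsupp.embDomain σ.toEmbedding n).degree : ℤ) = r then (1 : ℤ) else 0)
      rw [key]⟩

/-! Partitions are Young diagrams: with rows and columns numbered from `0`, the `i`-th part of `μ`
is `μ.rowLen i`, the number of nonzero parts is `μ.colLen 0`, and the size is `μ.card`. -/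

/-- The Schur function `s^{gl}_μ = det (h_{μ_i - i + j})` (universal character of type `gl`). -/
noncomputable def sGl (μ : YoungDiagram) : Lam :=
  Matrix.det (Matrix.of fun i j : Fin (μ.colLen 0) =>
    h ((μ.rowLen i : ℤ) - (i : ℤ) + (j : ℤ)))

/-- The universal orthogonal character of Koike and Terada,
`s^{so}_μ = det (h_{μ_i - i + j} - h_{μ_i - i - j})`, where `i, j ≥ 1`.
Below, `i` and `j` start at `0`. -/
noncomputable def sSo (μ : YoungDiagram) : Lam :=
  Matrix.det (Matrix.of fun i j : Fin (μ.colLen 0) =>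
    h ((μ.rowLen i : ℤ) - (i : ℤ) + (j : ℤ)) - h ((μ.rowLen i : ℤ) - (i : ℤ) - (j : ℤ) - 2))

/-- The universal symplectic character of Koike and Terada: the determinant with first column
`h_{μ_i - i + 1}` and with entries `h_{μ_i - i + j} + h_{μ_i - i - j + 2}` in the columns `j ≥ 2`,
where `i, j ≥ 1`. Below, `i` and `j` start at `0`. -/
noncomputable def sSp (μ : YoungDiagram) : Lam :=
  Matrix.det (Matrix.of fun i j : Fin (μ.colLen 0) =>
    if (j : ℕ) = 0 then h ((μ.rowLen i : ℤ) - (i : ℤ))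
    else h ((μ.rowLen i : ℤ) - (i : ℤ) + (j : ℤ)) + h ((μ.rowLen i : ℤ) - (i : ℤ) - (j : ℤ)))

/-- The Littlewood-Richardson coefficient `c^ν_{μ,γ}`: the coefficient of `s^{gl}_ν` in the
expansion of `s^{gl}_μ s^{gl}_γ` as a `ℤ`-linear combination of Schur functions. (Schur functions
are a `ℤ`-basis of `Λ`, so the linear combination map is bijective and `Function.invFun` is its
inverse.) -/
noncomputable def lrCoeff (μ γ ν : YoungDiagram) : ℤ :=
  Function.invFun (fun c : YoungDiagram →₀ ℤ => Finsupp.linearCombination ℤ sGl c)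
    (sGl μ * sGl γ) ν

/-- Partitions all of whose rows have even length, the set `𝒫^{(2)}`. -/
def evenRows : Set YoungDiagram := {μ | ∀ i, Even (μ.rowLen i)}

/-- Partitions all of whose columns have even length, the set `𝒫^{(1,1)}`. -/
def evenCols : Set YoungDiagram := {μ | ∀ j, Even (μ.colLen j)}

/-- `m^{so}_{k,μ} = ∑_{ν ∈ 𝒫^{(1,1)}, |ν| = 2k} ∑_{γ ∈ 𝒫^{(2)}} c^ν_{μ,γ}`. -/
noncomputable def mSo (k : ℕ) (μ : YoungDiagram) : ℤ :=
  ∑ᶠ ν ∈ {ν : YoungDiagram | ν ∈ evenCols ∧ ν.card = 2 * k}, ∑ᶠ γ ∈ evenRows, lrCoeff μ γ ν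

/-- `m^{sp}_{k,μ} = ∑_{ν ∈ 𝒫^{(2)}, |ν| = 2k} ∑_{γ ∈ 𝒫^{(1,1)}} c^ν_{μ,γ}`. -/
noncomputable def mSp (k : ℕ) (μ : YoungDiagram) : ℤ :=
  ∑ᶠ ν ∈ {ν : YoungDiagram | ν ∈ evenRows ∧ ν.card = 2 * k}, ∑ᶠ γ ∈ evenCols, lrCoeff μ γ ν

/-- The factor `1 / (1 - q x_i x_j)` in `ℤ[[x_0, x_1, …]][[q]]`, the inverse of a power series
in `q` with constant coefficient `1`. -/
noncomputable def factor (i j : ℕ) : PowerSeries (MvPowerSeries ℕ ℤ) :=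
  PowerSeries.invOfUnit
    (1 - PowerSeries.X * PowerSeries.C (MvPowerSeries.X i * MvPowerSeries.X j)) 1

/-- `F ∈ Λ[[q]]` is the universal graded character `∏_{i < j} 1 / (1 - q x_i x_j)` of type `so`:
the infinite product converges (coefficientwise) to `F`. -/
def IsCharSo (F : PowerSeries Lam) : Prop :=
  HasProd (fun p : {p : ℕ × ℕ // p.1 < p.2} => factor p.1.1 p.1.2)
    (PowerSeries.map Lam.subtype F)

/-- `F ∈ Λ[[q]]` is the universal graded character `∏_{i ≤ j} 1 / (1 - q x_i x_j)` of type `sp`: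
the infinite product converges (coefficientwise) to `F`. -/
def IsCharSp (F : PowerSeries Lam) : Prop :=
  HasProd (fun p : {p : ℕ × ℕ // p.1 ≤ p.2} => factor p.1.1 p.1.2)
    (PowerSeries.map Lam.subtype F)

end UniversalCharacters

/-!
Everything is compared with alternants in finitely many variables `t_1, …, t_n`. Littlewood's
identities expand the Vandermonde product divided by `∏_{i < j} (1 - q t_i t_j)`, respectively by
`∏_{i ≤ j} (1 - q t_i t_j)`, as the sum of the alternants `a_{ν + δ} q^{|ν| / 2}` over the
partitions `ν` with even columns, respectively even rows. By the bialternant formula these kernels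
are therefore the inverses of `∑ s_ν q^{|ν| / 2}`, and letting `n` grow expands the two infinite
products as `∑ s^gl_ν q^{|ν| / 2}`.

At `q = 1` the kernels are also what the Weyl denominators of type `so` and `sp` have in addition
to the Vandermonde product. The Jacobi–Trudi determinants of the universal characters thus say that
the generating function of the `s^so_μ` is that of the `s^gl_μ` times `∏_{i ≤ j} (1 - t_i t_j)`, and
similarly for `sp` with `i < j`. Dividing by the kernel gives the branching rule
`s^gl_ν = ∑ c^ν_{μ, γ} s^so_μ` over all `μ` and all `γ` with even rows (even columns for `sp`), and
inserting it into `∑ s^gl_ν q^{|ν| / 2}` produces the multiplicities.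
-/

namespace UniversalCharacters

/-! ### Alternants -/

section Alternants

variable {A B : Type*} [CommRing A] [CommRing B] {n : ℕ}

/-- The alternant `a_α(t) = det (t_i ^ α_j)`. -/
def alternant (t : Fin n → A) (α : Fin n → ℕ) : A := Matrix.det (Matrix.of fun i j => t i ^ α j)

/-- The exponent vector `δ = (n - 1, …, 1, 0)`. -/
def staircase (n : ℕ) : Fin n → ℕ := fun i => (Fin.rev i : ℕ)

/-- The Vandermonde product `a_δ(t) = ∏_{i < j} (t_i - t_j)`, the Weyl denominator of type `gl`. -/
def vandermonde (t : Fin n → A) : A := alternant t (staircase n)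

/-- The product of `f i j` over the pairs `i < j`. -/
def pairProd (f : Fin n → Fin n → A) : A := ∏ i, ∏ j ∈ Finset.Ioi i, f i j

theorem staircase_apply (i : Fin n) : staircase n i = n - 1 - i := by
  rw [staircase, Fin.val_rev]
  omega

theorem map_alternant (φ : A →+* B) (t : Fin n → A) (α : Fin n → ℕ) :
    φ (alternant t α) = alternant (fun i => φ (t i)) α := by
  rw [alternant, RingHom.map_det, alternant]
  congr 1
  ext i j
  simp

theorem map_vandermonde (φ : A →+* B) (t : Fin n → A) :
    φ (vandermonde t) = vandermonde fun i => φ (t i) :=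
  map_alternant φ t _

theorem vandermonde_eq_pairProd (t : Fin n → A) :
    vandermonde t = pairProd fun i j => t i - t j := by
  have h := Matrix.det_projVandermonde (fun _ => 1) t
  simp only [one_mul] at h
  rw [pairProd, ← h, vandermonde, alternant]
  congr 1
  ext i j
  simp [Matrix.projVandermonde_apply, staircase]

theorem alternant_comp_perm (t : Fin n → A) (α : Fin n → ℕ) (σ : Equiv.Perm (Fin n)) :
    alternant t (α ∘ σ) = (Equiv.Perm.sign σ : ℤ) * alternant t α :=
  Matrix.det_permute' σ (Matrix.of fun i j => t i ^ α j)

theorem alternant_perm_comp (t : Fin n → A) (α : Fin n → ℕ) (σ : Equiv.Perm (Fin n)) :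
    alternant (t ∘ σ) α = (Equiv.Perm.sign σ : ℤ) * alternant t α :=
  Matrix.det_permute σ (Matrix.of fun i j => t i ^ α j)

theorem alternant_eq_zero (t : Fin n → A) {α : Fin n → ℕ} {i j : Fin n} (hij : i ≠ j)
    (hα : α i = α j) : alternant t α = 0 :=
  Matrix.det_zero_of_column_eq hij fun k => by simp [hα]

theorem alternant_update_apply (t : Fin n → A) (α : Fin n → ℕ) (i j : Fin n) :
    alternant t (Function.update α i (α j)) = if j = i then alternant t α else 0 := by
  split_ifs with hji
  · rw [hji, Function.update_eq_self]
  · refine alternant_eq_zero t hji ?_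
    rw [Function.update_self, Function.update_of_ne hji]

theorem alternant_add_const (t : Fin n → A) (α : Fin n → ℕ) (s : ℕ) :
    alternant t (fun i => α i + s) = (∏ i, t i) ^ s * alternant t α := by
  rw [alternant, alternant, ← Finset.prod_pow, ← Matrix.det_mul_column]
  congr 1
  ext i j
  simp [pow_add, mul_comm]

theorem alternant_snoc_zero (t : Fin (n + 1) → A) (β : Fin n → ℕ) :
    alternant t (Fin.snoc (fun i => β i + 1) 0) =
      ∑ k : Fin (n + 1), (-1) ^ ((k : ℕ) + n) *
        ((∏ i, k.removeNth t i) * alternant (k.removeNth t) β) := by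
  rw [alternant, Matrix.det_succ_column _ (Fin.last n)]
  refine Finset.sum_congr rfl fun k _ => ?_
  have h_minor := alternant_add_const (k.removeNth t) β 1
  rw [pow_one] at h_minor
  rw [← h_minor, alternant]
  simp only [Matrix.of_apply, Fin.snoc_last, pow_zero, mul_one, Fin.val_last]
  congr 2
  ext i j
  simp [Fin.removeNth_apply]

theorem det_updateCol_alternant (t : Fin n → A) (α : Fin n → ℕ) (c : Fin n) (e : ℕ) (x : A) :
    ((Matrix.of fun i j : Fin n => t i ^ α j).updateCol c fun i => x * t i ^ e).det =
      x * alternant t (Function.update α c e) := by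
  change ((Matrix.of fun i j : Fin n => t i ^ α j).updateCol c (x • fun i => t i ^ e)).det = _
  rw [Matrix.det_updateCol_smul, alternant]
  congr 2
  ext i j
  obtain rfl | hj := eq_or_ne j c
  · simp
  · simp [Matrix.updateCol_ne hj, Function.update_of_ne hj]

theorem finRotate_apply_val (i : Fin (n + 1)) :
    (finRotate (n + 1) i : ℕ) = if (i : ℕ) = n then 0 else (i : ℕ) + 1 := by
  simp only [coe_finRotate, Fin.ext_iff, Fin.val_last]

theorem alternant_update_staircase_zero (t : Fin (n + 1) → A) :
    alternant t (Function.update (fun j => staircase (n + 1) j + 1) 0 0) =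
      (-1) ^ n * vandermonde t := by
  have h_rotate : staircase (n + 1) =
      Function.update (fun j => staircase (n + 1) j + 1) 0 0 ∘ finRotate (n + 1) := by
    ext j
    have hj := j.is_lt
    simp only [Function.comp_apply, Function.update_apply, Fin.ext_iff, finRotate_apply_val,
      staircase_apply, Fin.val_zero]
    split_ifs <;> first | omega | contradiction
  rw [vandermonde, h_rotate, alternant_comp_perm, sign_finRotate, ← h_rotate, ← mul_assoc]
  simp [← mul_pow]

theorem alternant_update_staircase_last (t : Fin (n + 1) → A) :
    alternant t (Function.update (fun j => staircase (n + 1) j + 1) (Fin.last n) (n + 2)) =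
      (-1) ^ n * ((∏ i, t i) ^ 2 * vandermonde t) := by
  have h_rotate : Function.update (fun j => staircase (n + 1) j + 1) (Fin.last n) (n + 2) =
      (fun j => staircase (n + 1) j + 2) ∘ finRotate (n + 1) := by
    ext j
    simp only [Function.comp_apply, Function.update_apply, Fin.ext_iff, finRotate_apply_val,
      staircase_apply, Fin.val_last]
    split_ifs <;> omega
  rw [h_rotate, alternant_comp_perm, sign_finRotate, alternant_add_const, vandermonde]
  simp

theorem alternant_update_staircase_succ (t : Fin (n + 1) → A) (c : Fin n) :
    alternant t (Function.update (fun j => staircase (n + 1) j + 1) c.succ (c + 1)) =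
      if c.rev = c then (∏ i, t i) * vandermonde t else 0 := by
  have h_exponent : (c : ℕ) + 1 = staircase (n + 1) c.rev.succ + 1 := by
    simp only [staircase_apply, Fin.val_succ, Fin.val_rev]
    omega
  rw [h_exponent, alternant_update_apply t (fun j => staircase (n + 1) j + 1),
    alternant_add_const, pow_one, vandermonde]
  simp only [Fin.succ_inj]

theorem alternant_update_staircase_castSucc (t : Fin (n + 1) → A) (c : Fin n) :
    alternant t (Function.update (fun j => staircase (n + 1) j + 1) c.castSucc (c + 2)) =
      if c.rev = c then (∏ i, t i) * vandermonde t else 0 := by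
  have h_exponent : (c : ℕ) + 2 = staircase (n + 1) c.rev.castSucc + 1 := by
    simp only [staircase_apply, Fin.val_castSucc, Fin.val_rev]
    omega
  rw [h_exponent, alternant_update_apply t (fun j => staircase (n + 1) j + 1),
    alternant_add_const, pow_one, vandermonde]
  simp only [Fin.castSucc_inj]

end Alternants

/-! ### The Littlewood kernels -/

section Kernels

variable {A B : Type*} [CommRing A] [CommRing B] {n : ℕ}

/-- The kernel `∏_{i < j} (1 - q t_i t_j)`. -/
def pairKernel (q : A) (t : Fin n → A) : A := pairProd fun i j => 1 - q * (t i * t j)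

/-- The kernel `∏_i (1 - q t_i²)`. -/
def diagKernel (q : A) (t : Fin n → A) : A := ∏ i, (1 - q * (t i * t i))

theorem map_pairProd (φ : A →+* B) (f : Fin n → Fin n → A) :
    φ (pairProd f) = pairProd fun i j => φ (f i j) := by
  simp only [pairProd, map_prod]

theorem map_pairKernel (φ : A →+* B) (q : A) (t : Fin n → A) :
    φ (pairKernel q t) = pairKernel (φ q) fun i => φ (t i) := by
  simp [pairKernel, map_pairProd]

theorem map_diagKernel (φ : A →+* B) (q : A) (t : Fin n → A) :
    φ (diagKernel q t) = diagKernel (φ q) fun i => φ (t i) := by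
  simp [diagKernel]

theorem pairProd_succAbove (f : Fin (n + 1) → Fin (n + 1) → A) (k : Fin (n + 1)) :
    pairProd f = (pairProd fun i j => f (k.succAbove i) (k.succAbove j)) *
      ∏ i : Fin n, if k.succAbove i < k then f (k.succAbove i) k else f k (k.succAbove i) := by
  have prod_Ioi (m : ℕ) (i : Fin m) (g : Fin m → A) :
      ∏ j ∈ Finset.Ioi i, g j = ∏ j, if i < j then g j else 1 := by
    rw [← Finset.prod_filter, Finset.filter_lt_eq_Ioi]
  simp only [pairProd, prod_Ioi]
  rw [Fin.prod_univ_succAbove _ k]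
  simp_rw [Fin.prod_univ_succAbove _ k, Fin.succAbove_lt_succAbove_iff]
  rw [Finset.prod_mul_distrib, if_neg (lt_irrefl k), one_mul, ← mul_assoc,
    ← Finset.prod_mul_distrib, mul_comm]
  congr 1
  refine Finset.prod_congr rfl fun i _ => ?_
  rcases lt_or_gt_of_ne (Fin.succAbove_ne k i) with hik | hki
  · simp [hik, hik.not_gt]
  · simp [hki, hki.not_gt]

theorem pairKernel_removeNth (q : A) (t : Fin (n + 1) → A) (k : Fin (n + 1)) :
    pairKernel q t = pairKernel q (k.removeNth t) * ∏ i, (1 - q * (t k * k.removeNth t i)) := by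
  rw [pairKernel, pairProd_succAbove _ k]
  congr 1
  refine Finset.prod_congr rfl fun i _ => ?_
  rw [mul_comm (t (k.succAbove i)), ite_self, Fin.removeNth_apply]

theorem diagKernel_removeNth (q : A) (t : Fin (n + 1) → A) (k : Fin (n + 1)) :
    diagKernel q t = diagKernel q (k.removeNth t) * (1 - q * (t k * t k)) := by
  rw [diagKernel, Fin.prod_univ_succAbove _ k, mul_comm]
  rfl

theorem prod_neg_one_succAbove (k : Fin (n + 1)) :
    (∏ i : Fin n, if k.succAbove i < k then (-1 : A) else 1) = (-1) ^ (k : ℕ) := by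
  have h_card : (Finset.univ.filter fun i : Fin n => k.succAbove i < k).card = k := by
    simp_rw [Fin.succAbove_lt_iff_castSucc_lt, Fin.lt_def, Fin.val_castSucc]
    rw [Fin.card_filter_val_lt]
    omega
  rw [Finset.prod_ite, Finset.prod_const, Finset.prod_const_one, mul_one, h_card]

end Kernels

section Kernels

variable {A : Type*} [CommRing A] {n : ℕ}

/-- The staircase alternant in `t` with the variable `t_k` removed, times the factors of the pair
kernel that contain `t_k`. -/
def cofactorKernel (q : A) (t : Fin (n + 1) → A) (k : Fin (n + 1)) : A :=
  (∏ i, k.removeNth t i) * vandermonde (k.removeNth t) * ∏ i, (1 - q * (t k * k.removeNth t i))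

/-- Both sides are the projective Vandermonde determinant with rows `(t_i : 1)`, `i ≠ k`, and
`(1 : q t_k)`. -/
theorem neg_one_pow_mul_cofactorKernel (q : A) (t : Fin (n + 1) → A) (k : Fin (n + 1)) :
    (-1) ^ (k : ℕ) * cofactorKernel q t k =
      ((Matrix.of fun i j : Fin (n + 1) => t i ^ (staircase (n + 1) j + 1)).updateRow k
        fun j => (q * t k) ^ (j : ℕ)).det := by
  set v : Fin (n + 1) → A := fun i => if i = k then q * t k else 1 with hv
  set w : Fin (n + 1) → A := fun i => if i = k then 1 else t i with hw
  have h_matrix : ((Matrix.of fun i j : Fin (n + 1) => t i ^ (staircase (n + 1) j + 1)).updateRow k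
      fun j => (q * t k) ^ (j : ℕ)) =
        Matrix.of fun i j => w i * Matrix.projVandermonde v w i j := by
    ext i j
    obtain rfl | hik := eq_or_ne i k
    · simp [hv, hw, Matrix.projVandermonde_apply]
    · simp [hv, hw, Matrix.projVandermonde_apply, hik, staircase, pow_succ']
  have h_pairs : ∏ i, ∏ j ∈ Finset.Ioi i, (v j * w i - v i * w j) =
      vandermonde (k.removeNth t) *
        ∏ i, ((if k.succAbove i < k then -1 else 1) * (1 - q * (t k * k.removeNth t i))) := by
    rw [← pairProd, pairProd_succAbove _ k, vandermonde_eq_pairProd]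
    simp only [hv, hw, Fin.succAbove_ne, if_true, if_false, one_mul, mul_one, Fin.removeNth_apply]
    congr 1
    refine Finset.prod_congr rfl fun i _ => ?_
    split_ifs <;> ring
  rw [h_matrix, Matrix.det_mul_column, Matrix.det_projVandermonde, h_pairs,
    Finset.prod_mul_distrib, prod_neg_one_succAbove, Fin.prod_univ_succAbove w k, cofactorKernel]
  simp only [hw, Fin.succAbove_ne, if_true, if_false, one_mul, Fin.removeNth_apply]
  ring

theorem sum_det_updateRow {ι : Type*} [Fintype ι] [DecidableEq ι] (M N : Matrix ι ι A) :
    ∑ k, (M.updateRow k (N k)).det = ∑ c, (M.updateCol c (N.col c)).det := by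
  have h_row (k : ι) : (M.updateRow k (N k)).det = ∑ c, M.adjugate c k * N k c := by
    rw [← Matrix.cramer_transpose_apply, Matrix.cramer_eq_adjugate_mulVec,
      ← Matrix.adjugate_transpose]
    rfl
  have h_col (c : ι) : (M.updateCol c (N.col c)).det = ∑ k, M.adjugate c k * N k c := by
    rw [← Matrix.cramer_apply, Matrix.cramer_eq_adjugate_mulVec]
    rfl
  simp_rw [h_row, h_col]
  exact Finset.sum_comm

theorem sum_pow_mul_cofactorKernel (q : A) (t : Fin (n + 1) → A) (e : ℕ) :
    ∑ k : Fin (n + 1), (-1) ^ (k : ℕ) * (t k ^ e * cofactorKernel q t k) =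
      ∑ c : Fin (n + 1), q ^ (c : ℕ) *
        alternant t (Function.update (fun j => staircase (n + 1) j + 1) c (c + e)) := by
  calc ∑ k : Fin (n + 1), (-1) ^ (k : ℕ) * (t k ^ e * cofactorKernel q t k)
      = ∑ k, ((Matrix.of fun i j => t i ^ (staircase (n + 1) j + 1)).updateRow k
          (t k ^ e • fun j : Fin (n + 1) => (q * t k) ^ (j : ℕ))).det := by
        refine Finset.sum_congr rfl fun k _ => ?_
        rw [Matrix.det_updateRow_smul, ← neg_one_pow_mul_cofactorKernel, mul_left_comm]
    _ = ∑ c, ((Matrix.of fun i j => t i ^ (staircase (n + 1) j + 1)).updateCol c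
          fun i => q ^ (c : ℕ) * t i ^ ((c : ℕ) + e)).det := by
        refine (sum_det_updateRow _ fun k j => t k ^ e * (q * t k) ^ (j : ℕ)).trans ?_
        refine Finset.sum_congr rfl fun c _ => ?_
        congr 2
        ext i
        change t i ^ e * (q * t i) ^ (c : ℕ) = _
        ring
    _ = _ := Finset.sum_congr rfl fun c _ => det_updateCol_alternant ..

theorem sum_rev_eq_self (q : A) :
    (∑ c : Fin n, if c.rev = c then q ^ ((c : ℕ) + 1) else 0) =
      if Even (n + 1) then q ^ ((n + 1) / 2) else 0 := by
  split_ifs with h_even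
  · obtain ⟨m, hm⟩ := h_even
    rw [Finset.sum_eq_single ⟨m - 1, by omega⟩]
    · rw [if_pos (by simp only [Fin.ext_iff, Fin.val_rev]; omega)]
      congr 1
      simp only
      omega
    · intro c _ hc
      refine if_neg fun h_fixed => hc ?_
      simp only [Fin.ext_iff, Fin.val_rev] at h_fixed ⊢
      omega
    · simp
  · refine Finset.sum_eq_zero fun c _ => if_neg fun h_fixed => h_even ⟨c + 1, ?_⟩
    simp only [Fin.ext_iff, Fin.val_rev] at h_fixed
    omega

theorem sum_neg_one_pow_mul_cofactorKernel (q : A) (t : Fin (n + 1) → A) :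
    ∑ k : Fin (n + 1), (-1) ^ (k : ℕ) * cofactorKernel q t k =
      (-1) ^ n * vandermonde t +
        (∑ c : Fin n, if c.rev = c then q ^ ((c : ℕ) + 1) else 0) *
          ((∏ i, t i) * vandermonde t) := by
  have h_sum := sum_pow_mul_cofactorKernel q t 0
  rw [Fin.sum_univ_succ (n := n) fun c => q ^ (c : ℕ) * _] at h_sum
  simpa only [pow_zero, one_mul, Fin.val_zero, add_zero, alternant_update_staircase_zero,
    Fin.val_succ, alternant_update_staircase_succ, mul_ite, ite_mul, mul_zero, zero_mul,
    Finset.sum_mul] using h_sum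

theorem sum_neg_one_pow_mul_sq_mul_cofactorKernel (q : A) (t : Fin (n + 1) → A) :
    q * ∑ k : Fin (n + 1), (-1) ^ (k : ℕ) * (t k ^ 2 * cofactorKernel q t k) =
      (-1) ^ n * (q ^ (n + 1) * (∏ i, t i) ^ 2 * vandermonde t) +
        (∑ c : Fin n, if c.rev = c then q ^ ((c : ℕ) + 1) else 0) *
          ((∏ i, t i) * vandermonde t) := by
  rw [sum_pow_mul_cofactorKernel, Fin.sum_univ_castSucc, mul_add, Finset.mul_sum, add_comm,
    Finset.sum_mul]
  simp only [Fin.val_castSucc, alternant_update_staircase_castSucc, Fin.val_last,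
    alternant_update_staircase_last, pow_succ]
  congr 1
  · ring
  · refine Finset.sum_congr rfl fun c _ => ?_
    split_ifs <;> ring

theorem sum_cofactorKernel (q : A) (t : Fin (n + 1) → A) :
    ∑ k : Fin (n + 1), (-1) ^ ((k : ℕ) + n) * cofactorKernel q t k =
      (1 - if Even (n + 1) then q ^ ((n + 1) / 2) * ∏ i, t i else 0) * vandermonde t := by
  simp_rw [add_comm _ n, pow_add, mul_assoc]
  rw [← Finset.mul_sum, sum_neg_one_pow_mul_cofactorKernel, sum_rev_eq_self]
  split_ifs with h_even
  · rw [Odd.neg_one_pow (by simpa [Nat.even_add_one] using h_even)]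
    ring
  · rw [Even.neg_one_pow (by simpa [Nat.even_add_one] using h_even)]
    ring

theorem sum_cofactorKernel_mul_one_sub (q : A) (t : Fin (n + 1) → A) :
    ∑ k : Fin (n + 1), (-1) ^ ((k : ℕ) + n) * (cofactorKernel q t k * (1 - q * (t k * t k))) =
      (1 - q ^ (n + 1) * (∏ i, t i) ^ 2) * vandermonde t := by
  calc ∑ k : Fin (n + 1), (-1) ^ ((k : ℕ) + n) * (cofactorKernel q t k * (1 - q * (t k * t k)))
      = (-1) ^ n * (∑ k : Fin (n + 1), (-1) ^ (k : ℕ) * cofactorKernel q t k -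
          q * ∑ k : Fin (n + 1), (-1) ^ (k : ℕ) * (t k ^ 2 * cofactorKernel q t k)) := by
        simp only [Finset.mul_sum, ← Finset.sum_sub_distrib]
        exact Finset.sum_congr rfl fun k _ => by ring
    _ = ((-1) ^ n * (-1) ^ n) * ((1 - q ^ (n + 1) * (∏ i, t i) ^ 2) * vandermonde t) := by
        rw [sum_neg_one_pow_mul_cofactorKernel, sum_neg_one_pow_mul_sq_mul_cofactorKernel]
        ring
    _ = (1 - q ^ (n + 1) * (∏ i, t i) ^ 2) * vandermonde t := by
        rw [← mul_pow, neg_one_mul, neg_neg, one_pow, one_mul]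

end Kernels

/-! ### Littlewood's identities -/

section AlternantSeries

variable {A : Type*} [CommRing A] {n : ℕ}

open scoped Classical in
/-- The generating series `∑_{f ∈ S} a_{f + δ}(t) X^{|f|}` of the alternants indexed by `S`. -/
noncomputable def alternantSeries (t : Fin n → A) (S : Set (Fin n → ℕ)) : PowerSeries A :=
  PowerSeries.mk fun d => ∑ f ∈ Finset.piAntidiag Finset.univ d with f ∈ S,
    alternant t fun i => f i + staircase n i

/-- The partitions with at most `n` parts all of whose rows have even length. -/
def evenRowTuples (n : ℕ) : Set (Fin n → ℕ) := {f | Antitone f ∧ ∀ i, Even (f i)}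

/-- The partitions with at most `n` parts all of whose columns have even length. -/
def evenColTuples (n : ℕ) : Set (Fin n → ℕ) :=
  {f | Antitone f ∧ ∀ j, Even (Finset.univ.filter fun i => j < f i).card}

open scoped Classical in
theorem coeff_alternantSeries (t : Fin n → A) (S : Set (Fin n → ℕ)) (d : ℕ) :
    PowerSeries.coeff d (alternantSeries t S) =
      ∑ f ∈ Finset.piAntidiag Finset.univ d with f ∈ S,
        alternant t fun i => f i + staircase n i := by
  rw [alternantSeries, PowerSeries.coeff_mk]

theorem alternantSeries_empty (t : Fin n → A) : alternantSeries t ∅ = 0 := by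
  ext d
  simp [coeff_alternantSeries]

theorem alternantSeries_of_isEmpty (t : Fin 0 → A) {S : Set (Fin 0 → ℕ)}
    (hS : Fin.elim0 ∈ S) : alternantSeries t S = 1 := by
  classical
  ext d
  rw [coeff_alternantSeries, PowerSeries.coeff_one,
    Finset.filter_true_of_mem fun f _ => Subsingleton.elim Fin.elim0 f ▸ hS]
  obtain rfl | hd := eq_or_ne d 0
  · simp [alternant]
  · simp [hd]

theorem alternantSeries_union (t : Fin n → A) {S T : Set (Fin n → ℕ)} (hST : Disjoint S T) :
    alternantSeries t (S ∪ T) = alternantSeries t S + alternantSeries t T := by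
  classical
  ext d
  simp only [map_add, coeff_alternantSeries, Set.mem_union, Finset.filter_or]
  exact Finset.sum_union (Finset.disjoint_filter.2 fun f _ hS hT =>
    Set.disjoint_left.1 hST hS hT)

theorem alternantSeries_image_snoc_zero (t : Fin (n + 1) → A) (S : Set (Fin n → ℕ)) :
    alternantSeries t ((fun f => Fin.snoc (α := fun _ => ℕ) f 0) '' S) =
      ∑ k : Fin (n + 1), (-1) ^ ((k : ℕ) + n) *
        (PowerSeries.C (∏ i, k.removeNth t i) * alternantSeries (k.removeNth t) S) := by
  classical
  have h_injective :
      Function.Injective fun f : Fin n → ℕ => (Fin.snoc (α := fun _ => ℕ) f 0 : Fin (n + 1) → ℕ) :=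
    fun f g hfg => (Fin.snoc_inj.1 hfg).1
  ext d
  have h_filter : (Finset.piAntidiag Finset.univ d).filter
        (· ∈ (fun f => Fin.snoc (α := fun _ => ℕ) f 0) '' S) =
      ((Finset.piAntidiag Finset.univ d).filter (· ∈ S)).image
        fun f => Fin.snoc (α := fun _ => ℕ) f 0 := by
    ext f
    simp only [Finset.mem_filter, Finset.mem_piAntidiag, Finset.mem_image, Set.mem_image]
    constructor
    · rintro ⟨⟨rfl, -⟩, g, hg, rfl⟩
      exact ⟨g, ⟨by simp [Fin.sum_univ_castSucc], hg⟩, rfl⟩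
    · rintro ⟨g, ⟨⟨rfl, -⟩, hg⟩, rfl⟩
      exact ⟨by simp [Fin.sum_univ_castSucc], g, hg, rfl⟩
  have h_exponent (f : Fin n → ℕ) :
      (fun i => Fin.snoc (α := fun _ => ℕ) f 0 i + staircase (n + 1) i) =
        Fin.snoc (α := fun _ => ℕ) (fun i => f i + staircase n i + 1) 0 := by
    ext i
    induction i using Fin.lastCases with
    | last => simp [staircase_apply]
    | cast i =>
      simp only [Fin.snoc_castSucc, staircase_apply, Fin.val_castSucc]
      omega
  rw [coeff_alternantSeries, h_filter, Finset.sum_image h_injective.injOn]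
  simp_rw [h_exponent, alternant_snoc_zero t fun i => _ + staircase n i]
  rw [Finset.sum_comm, map_sum]
  refine Finset.sum_congr rfl fun k _ => ?_
  rw [← map_one PowerSeries.C, ← map_neg, ← map_pow, PowerSeries.coeff_C_mul,
    PowerSeries.coeff_C_mul, coeff_alternantSeries, Finset.mul_sum, Finset.mul_sum]

theorem alternantSeries_image_add (t : Fin n → A) (S : Set (Fin n → ℕ)) (s : ℕ) :
    alternantSeries t ((fun f i => f i + s) '' S) =
      PowerSeries.X ^ (s * n) * PowerSeries.C (∏ i, t i) ^ s * alternantSeries t S := by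
  classical
  have h_injective : Function.Injective fun (f : Fin n → ℕ) i => f i + s :=
    fun f g hfg => funext fun i => Nat.add_right_cancel (congrFun hfg i)
  have h_sum (f : Fin n → ℕ) : ∑ i, (f i + s) = Finset.univ.sum f + s * n := by
    simp [Finset.sum_add_distrib, mul_comm]
  ext d
  have h_filter : (Finset.piAntidiag Finset.univ d).filter (· ∈ (fun f i => f i + s) '' S) =
      if s * n ≤ d then ((Finset.piAntidiag Finset.univ (d - s * n)).filter (· ∈ S)).image
        fun f i => f i + s else ∅ := by
    ext f
    split_ifs with hd
    · simp only [Finset.mem_filter, Finset.mem_piAntidiag, Finset.mem_image, Set.mem_image]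
      constructor
      · rintro ⟨⟨rfl, -⟩, g, hg, rfl⟩
        exact ⟨g, ⟨⟨by rw [h_sum]; omega, by simp⟩, hg⟩, rfl⟩
      · rintro ⟨g, ⟨⟨h_size, -⟩, hg⟩, rfl⟩
        exact ⟨⟨by rw [h_sum]; omega, by simp⟩, g, hg, rfl⟩
    · simp only [Finset.mem_filter, Finset.mem_piAntidiag, Set.mem_image, Finset.notMem_empty,
        iff_false]
      rintro ⟨⟨rfl, -⟩, g, -, rfl⟩
      exact hd (by rw [h_sum]; omega)
  rw [coeff_alternantSeries, h_filter, mul_assoc, PowerSeries.coeff_X_pow_mul', ← map_pow,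
    PowerSeries.coeff_C_mul, coeff_alternantSeries, Finset.mul_sum]
  split_ifs
  · rw [Finset.sum_image h_injective.injOn]
    refine Finset.sum_congr rfl fun f _ => ?_
    rw [← alternant_add_const]
    simp only [add_right_comm]
  · simp

theorem alternantSeries_eq_sum_add (t : Fin (n + 1) → A) {S T : Set (Fin (n + 1) → ℕ)}
    {S' : Set (Fin n → ℕ)} {s : ℕ} (hs : s ≠ 0)
    (hS : S = (fun f => Fin.snoc (α := fun _ => ℕ) f 0) '' S' ∪ (fun f i => f i + s) '' T) :
    alternantSeries t S =
      ∑ k : Fin (n + 1), (-1) ^ ((k : ℕ) + n) *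
        (PowerSeries.C (∏ i, k.removeNth t i) * alternantSeries (k.removeNth t) S') +
      PowerSeries.X ^ (s * (n + 1)) * PowerSeries.C (∏ i, t i) ^ s * alternantSeries t T := by
  rw [hS, alternantSeries_union, alternantSeries_image_snoc_zero, alternantSeries_image_add]
  rw [Set.disjoint_left]
  rintro _ ⟨f, -, rfl⟩ ⟨g, -, hg⟩
  have h_last := congrFun hg (Fin.last n)
  simp [hs] at h_last

theorem antitone_snoc_zero {f : Fin n → ℕ} :
    Antitone (Fin.snoc (α := fun _ => ℕ) f 0 : Fin (n + 1) → ℕ) ↔ Antitone f := by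
  constructor
  · intro hf i j hij
    simpa using hf (Fin.castSucc_le_castSucc_iff.2 hij)
  · intro hf i j hij
    induction j using Fin.lastCases with
    | last => simp
    | cast j =>
      induction i using Fin.lastCases with
      | last => exact absurd hij (by simp [Fin.le_def])
      | cast i => simpa using hf (Fin.castSucc_le_castSucc_iff.1 hij)

theorem eq_snoc_zero {f : Fin (n + 1) → ℕ} (hf : f (Fin.last n) = 0) :
    f = Fin.snoc (α := fun _ => ℕ) (fun i => f i.castSucc) 0 := by
  rw [← hf]
  exact (Fin.snoc_init_self f).symm

theorem eq_sub_add {f : Fin (n + 1) → ℕ} (hf : Antitone f) {s : ℕ} (hs : s ≤ f (Fin.last n)) :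
    f = fun i => f i - s + s :=
  funext fun i => (Nat.sub_add_cancel (hs.trans (hf (Fin.le_last i)))).symm

theorem evenRowTuples_succ (n : ℕ) :
    evenRowTuples (n + 1) = (fun f => Fin.snoc (α := fun _ => ℕ) f 0) '' evenRowTuples n ∪
      (fun f i => f i + 2) '' evenRowTuples (n + 1) := by
  ext f
  constructor
  · rintro ⟨h_anti, h_even⟩
    obtain h_last | h_last := eq_or_ne (f (Fin.last n)) 0
    · refine Or.inl ⟨_, ⟨?_, fun i => h_even i.castSucc⟩, (eq_snoc_zero h_last).symm⟩
      exact fun i j hij => h_anti (Fin.castSucc_le_castSucc_iff.2 hij)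
    · have h_two : 2 ≤ f (Fin.last n) := by
        obtain ⟨a, ha⟩ := h_even (Fin.last n)
        omega
      refine Or.inr ⟨_, ⟨fun i j hij => Nat.sub_le_sub_right (h_anti hij) 2, fun i => ?_⟩,
        (eq_sub_add h_anti h_two).symm⟩
      exact (h_even i).tsub even_two
  · rintro (⟨g, ⟨h_anti, h_even⟩, rfl⟩ | ⟨g, ⟨h_anti, h_even⟩, rfl⟩)
    · exact ⟨antitone_snoc_zero.2 h_anti, by simpa [Fin.forall_fin_succ'] using h_even⟩
    · exact ⟨fun i j hij => Nat.add_le_add_right (h_anti hij) 2,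
        fun i => (h_even i).add even_two⟩

theorem snoc_zero_mem_evenColTuples {f : Fin n → ℕ} :
    (Fin.snoc (α := fun _ => ℕ) f 0 : Fin (n + 1) → ℕ) ∈ evenColTuples (n + 1) ↔
      f ∈ evenColTuples n := by
  refine and_congr antitone_snoc_zero (forall_congr' fun j => ?_)
  rw [Finset.card_filter, Fin.sum_univ_castSucc, Finset.card_filter]
  simp

theorem add_one_mem_evenColTuples {f : Fin n → ℕ} :
    (fun i => f i + 1) ∈ evenColTuples n ↔ Even n ∧ f ∈ evenColTuples n := by
  have h_anti : Antitone (fun i => f i + 1) ↔ Antitone f :=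
    ⟨fun h i j hij => Nat.le_of_add_le_add_right (h hij),
      fun h i j hij => Nat.add_le_add_right (h hij) 1⟩
  have h_even : (∀ j, Even (Finset.univ.filter fun i => j < f i + 1).card) ↔
      Even n ∧ ∀ j, Even (Finset.univ.filter fun i => j < f i).card := by
    refine ⟨fun h => ⟨by simpa using h 0, fun j => by simpa using h (j + 1)⟩, ?_⟩
    rintro ⟨h_zero, h_succ⟩ (_ | j)
    · simpa using h_zero
    · simpa using h_succ j
  rw [evenColTuples, Set.mem_ofPred_eq, Set.mem_ofPred_eq, h_anti, h_even]
  tauto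

theorem evenColTuples_succ (n : ℕ) :
    evenColTuples (n + 1) = (fun f => Fin.snoc (α := fun _ => ℕ) f 0) '' evenColTuples n ∪
      (fun f i => f i + 1) '' {f | Even (n + 1) ∧ f ∈ evenColTuples (n + 1)} := by
  ext f
  constructor
  · intro hf
    obtain h_last | h_last := eq_or_ne (f (Fin.last n)) 0
    · have h_snoc := eq_snoc_zero h_last
      rw [h_snoc, snoc_zero_mem_evenColTuples] at hf
      exact Or.inl ⟨_, hf, h_snoc.symm⟩
    · have h_sub := eq_sub_add hf.1 (Nat.one_le_iff_ne_zero.2 h_last)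
      rw [h_sub, add_one_mem_evenColTuples (f := fun i => f i - 1)] at hf
      exact Or.inr ⟨_, hf, h_sub.symm⟩
  · rintro (⟨g, hg, rfl⟩ | ⟨g, hg, rfl⟩)
    · exact snoc_zero_mem_evenColTuples.2 hg
    · exact add_one_mem_evenColTuples.2 hg

end AlternantSeries

section LittlewoodIdentities

variable {A : Type*} [CommRing A] {n : ℕ}

theorem isUnit_one_sub_X_pow_mul {m : ℕ} (hm : m ≠ 0) (F : PowerSeries A) :
    IsUnit (1 - PowerSeries.X ^ m * F) := by
  rw [PowerSeries.isUnit_iff_constantCoeff]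
  simp [hm]

theorem vandermonde_C (t : Fin n → A) :
    vandermonde (fun i => PowerSeries.C (t i)) = PowerSeries.C (vandermonde t) :=
  (map_vandermonde PowerSeries.C t).symm

theorem pairKernel_mul_diagKernel_mul_alternantSeries (t : Fin n → A) :
    pairKernel (PowerSeries.X ^ 2) (fun i => PowerSeries.C (t i)) *
      diagKernel (PowerSeries.X ^ 2) (fun i => PowerSeries.C (t i)) *
        alternantSeries t (evenRowTuples n) = PowerSeries.C (vandermonde t) := by
  induction n with
  | zero =>
    rw [alternantSeries_of_isEmpty t (S := evenRowTuples 0)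
      ⟨fun i => i.elim0, fun i => i.elim0⟩]
    simp [pairKernel, diagKernel, pairProd, vandermonde, alternant]
  | succ n ih =>
    have h_series := alternantSeries_eq_sum_add t two_ne_zero (evenRowTuples_succ n)
    rw [← sub_eq_iff_eq_add, ← one_sub_mul] at h_series
    have h_kernel := sum_cofactorKernel_mul_one_sub (PowerSeries.X ^ 2) fun i => PowerSeries.C (t i)
    rw [vandermonde_C, ← map_prod, ← pow_mul] at h_kernel
    refine (isUnit_one_sub_X_pow_mul (m := 2 * (n + 1)) (by omega)
      (PowerSeries.C (∏ i, t i) ^ 2)).mul_left_cancel ?_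
    rw [mul_left_comm, h_series, ← h_kernel, Finset.mul_sum]
    refine Finset.sum_congr rfl fun k _ => ?_
    have h_removeNth : (k.removeNth fun i => PowerSeries.C (t i)) =
        fun i => PowerSeries.C (k.removeNth t i) := rfl
    rw [pairKernel_removeNth _ _ k, diagKernel_removeNth _ _ k, cofactorKernel, h_removeNth,
      vandermonde_C, ← ih (k.removeNth t), map_prod]
    ring

theorem pairKernel_mul_alternantSeries (t : Fin n → A) :
    pairKernel (PowerSeries.X ^ 2) (fun i => PowerSeries.C (t i)) *
      alternantSeries t (evenColTuples n) = PowerSeries.C (vandermonde t) := by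
  induction n with
  | zero =>
    rw [alternantSeries_of_isEmpty t (S := evenColTuples 0) ⟨fun i => i.elim0, by simp⟩]
    simp [pairKernel, pairProd, vandermonde, alternant]
  | succ n ih =>
    have h_series := alternantSeries_eq_sum_add t one_ne_zero (evenColTuples_succ n)
    have h_kernel := sum_cofactorKernel (PowerSeries.X ^ 2) fun i => PowerSeries.C (t i)
    rw [vandermonde_C, ← map_prod] at h_kernel
    have h_sum : pairKernel (PowerSeries.X ^ 2) (fun i => PowerSeries.C (t i)) *
        ∑ k : Fin (n + 1), (-1) ^ ((k : ℕ) + n) * (PowerSeries.C (∏ i, k.removeNth t i) *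
          alternantSeries (k.removeNth t) (evenColTuples n)) =
        ∑ k : Fin (n + 1), (-1) ^ ((k : ℕ) + n) *
          cofactorKernel (PowerSeries.X ^ 2) (fun i => PowerSeries.C (t i)) k := by
      rw [Finset.mul_sum]
      refine Finset.sum_congr rfl fun k _ => ?_
      have h_removeNth : (k.removeNth fun i => PowerSeries.C (t i)) =
          fun i => PowerSeries.C (k.removeNth t i) := rfl
      rw [pairKernel_removeNth _ _ k, cofactorKernel, h_removeNth, vandermonde_C,
        ← ih (k.removeNth t), map_prod]
      ring
    rw [← h_sum] at h_kernel
    split_ifs at h_kernel with h_even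
    · rw [← pow_mul, Nat.mul_div_cancel' h_even.two_dvd] at h_kernel
      simp only [h_even, true_and, Set.ofPred_mem_eq, one_mul, pow_one] at h_series
      rw [← sub_eq_iff_eq_add, ← one_sub_mul] at h_series
      refine (isUnit_one_sub_X_pow_mul n.succ_ne_zero
        (PowerSeries.C (∏ i, t i))).mul_left_cancel ?_
      rw [mul_left_comm, h_series, h_kernel]
    · simp only [h_even, false_and, Set.ofPred_false, alternantSeries_empty, mul_zero,
        add_zero] at h_series
      rw [h_series, h_kernel, sub_zero, one_mul]

end LittlewoodIdentities

/-! ### Weyl denominators -/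

section WeylDenominators

open Polynomial

variable {A : Type*} [CommRing A] {n : ℕ}

theorem eval_homogenize_eq_sum (p : A[X]) (N : ℕ) (v w : A) :
    MvPolynomial.eval ![v, w] (p.homogenize N) =
      ∑ m : Fin (N + 1), v ^ (m : ℕ) * w ^ (N - m) * p.coeff m := by
  rw [homogenize, map_sum, Finset.Nat.sum_antidiagonal_eq_sum_range_succ_mk,
    ← Fin.sum_univ_eq_sum_range fun m => MvPolynomial.eval ![v, w] _]
  refine Finset.sum_congr rfl fun m _ => ?_
  simp [MvPolynomial.eval_monomial, Finsupp.prod_fintype, mul_comm]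

theorem det_eval_homogenize (v w : Fin n → A) (p : ℕ → A[X])
    (hp : ∀ j, IsMonicOfDegree (p j) j) :
    (Matrix.of fun i j : Fin n =>
      MvPolynomial.eval ![v i, w i] ((p j).homogenize j) * w i ^ staircase n j).det =
        (Matrix.projVandermonde v w).det := by
  have h_det := Matrix.det_matrixOfPolynomials (fun j : Fin n => p j)
    (fun j => (hp j).natDegree_eq) fun j => (hp j).monic
  rw [← mul_one (Matrix.projVandermonde v w).det, ← h_det, ← Matrix.det_mul]
  congr 1
  ext i j
  obtain ⟨N, rfl⟩ := Nat.exists_eq_add_one.2 j.pos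
  have h_degree : (j : ℕ) + staircase (N + 1) j = N := by
    have := j.is_le
    simp only [staircase_apply]
    omega
  have h_homogenize : (p j).homogenize N =
      (p j).homogenize j * MvPolynomial.X 1 ^ staircase (N + 1) j := by
    rw [← homogenize_one, ← homogenize_mul _ _ (hp j).natDegree_eq.le (by simp), mul_one, h_degree]
  have h_eval := congrArg (MvPolynomial.eval ![v i, w i]) h_homogenize
  rw [eval_homogenize_eq_sum, map_mul] at h_eval
  simpa [Matrix.mul_apply, Matrix.projVandermonde_apply, Fin.val_rev, mul_assoc] using h_eval.symm

theorem det_projVandermonde_one_add_sq (t : Fin n → A) :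
    (Matrix.projVandermonde (fun i => 1 + t i ^ 2) t).det = vandermonde t * pairKernel 1 t := by
  simp only [Matrix.det_projVandermonde, vandermonde_eq_pairProd, pairKernel, pairProd,
    ← Finset.prod_mul_distrib]
  exact Finset.prod_congr rfl fun i _ => Finset.prod_congr rfl fun j _ => by ring

theorem eval_homogenize_X_mul_sub {p q : A[X]} {j : ℕ} (hp : p.natDegree ≤ j + 1)
    (hq : q.natDegree ≤ j) (x : A) :
    MvPolynomial.eval ![1 + x ^ 2, x] ((X * p - q).homogenize (j + 2)) =
      (1 + x ^ 2) * MvPolynomial.eval ![1 + x ^ 2, x] (p.homogenize (j + 1)) -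
        x ^ 2 * MvPolynomial.eval ![1 + x ^ 2, x] (q.homogenize j) := by
  have h_left : (X * p).homogenize (1 + (j + 1)) = MvPolynomial.X 0 * p.homogenize (j + 1) := by
    rw [homogenize_mul _ _ natDegree_X_le hp, homogenize_X one_ne_zero, Nat.sub_self, pow_zero,
      mul_one]
  have h_right : (1 * q).homogenize (2 + j) = MvPolynomial.X 1 ^ 2 * q.homogenize j := by
    rw [homogenize_mul _ _ (by simp) hq, homogenize_one]
  rw [one_mul] at h_right
  rw [homogenize_sub, show j + 2 = 1 + (j + 1) by omega, h_left,
    ← show 2 + j = 1 + (j + 1) by omega, h_right]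
  simp

theorem isMonicOfDegree_chebyshev_step [Nontrivial A] {p q : A[X]} {j : ℕ}
    (hp : IsMonicOfDegree p (j + 1)) (hq : IsMonicOfDegree q j) :
    IsMonicOfDegree (X * p - q) (j + 2) := by
  have h_mul := (isMonicOfDegree_X A).mul hp
  rw [show 1 + (j + 1) = j + 2 by omega] at h_mul
  exact h_mul.sub (hq.natDegree_eq.trans_lt (by omega))

theorem isMonicOfDegree_chebyshev_S [Nontrivial A] (j : ℕ) :
    IsMonicOfDegree (Chebyshev.S A j) j := by
  induction j using Nat.twoStepInduction with
  | zero => simp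
  | one => simpa using isMonicOfDegree_X A
  | more j ih ih_succ =>
    push_cast at ih_succ ⊢
    rw [Chebyshev.S_add_two]
    exact isMonicOfDegree_chebyshev_step ih_succ ih

theorem isMonicOfDegree_chebyshev_C [Nontrivial A] (j : ℕ) :
    IsMonicOfDegree (Chebyshev.C A (j + 1 : ℕ)) (j + 1) := by
  induction j using Nat.twoStepInduction with
  | zero => simpa using isMonicOfDegree_X A
  | one =>
    simpa [Chebyshev.C_two] using
      (isMonicOfDegree_X_pow A 2).sub (q := 2) (by simp [natDegree_ofNat])
  | more j ih ih_succ =>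
    have h_rec := Chebyshev.C_add_two A (j + 1 : ℕ)
    push_cast at ih ih_succ h_rec ⊢
    rw [show (j : ℤ) + 2 + 1 = j + 1 + 2 by ring, h_rec]
    exact isMonicOfDegree_chebyshev_step ih_succ ih

theorem natDegree_chebyshev_C_le [Nontrivial A] (j : ℕ) : (Chebyshev.C A j).natDegree ≤ j := by
  cases j with
  | zero => simp [natDegree_ofNat]
  | succ j => exact (isMonicOfDegree_chebyshev_C j).natDegree_eq.le

/-- The value at `(1 + x², x)` of the homogenization of `P` in degree `j` is `x ^ j P(x + x⁻¹)`. -/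
theorem one_sub_sq_mul_eval_homogenize_chebyshev_S [Nontrivial A] (x : A) (j : ℕ) :
    (1 - x ^ 2) * MvPolynomial.eval ![1 + x ^ 2, x] ((Chebyshev.S A j).homogenize j) =
      1 - x ^ (2 * j + 2) := by
  induction j using Nat.twoStepInduction with
  | zero => simp
  | one => simp; ring
  | more j ih ih_succ =>
    have h_step := eval_homogenize_X_mul_sub (isMonicOfDegree_chebyshev_S (A := A) (j + 1)).1.le
      (isMonicOfDegree_chebyshev_S (A := A) j).1.le x
    push_cast at ih_succ h_step ⊢
    rw [Chebyshev.S_add_two, h_step]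
    linear_combination (1 + x ^ 2) * ih_succ - x ^ 2 * ih

theorem eval_homogenize_chebyshev_C [Nontrivial A] (x : A) (j : ℕ) :
    MvPolynomial.eval ![1 + x ^ 2, x] ((Chebyshev.C A j).homogenize j) = 1 + x ^ (2 * j) := by
  induction j using Nat.twoStepInduction with
  | zero =>
    have h_two : (2 : A[X]).homogenize 0 = 2 := by
      rw [← C_ofNat, homogenize_C, pow_zero, mul_one, map_ofNat]
    simp [h_two, one_add_one_eq_two]
  | one => simp
  | more j ih ih_succ =>
    have h_step := eval_homogenize_X_mul_sub (natDegree_chebyshev_C_le (A := A) (j + 1))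
      (natDegree_chebyshev_C_le (A := A) j) x
    push_cast at ih_succ h_step ⊢
    rw [Chebyshev.C_add_two, h_step]
    linear_combination (1 + x ^ 2) * ih_succ - x ^ 2 * ih

theorem det_so_denominator (t : Fin n → A) :
    (Matrix.of fun i j : Fin n =>
      t i ^ staircase n j - t i ^ (staircase n j + 2 * (j : ℕ) + 2)).det =
        vandermonde t * (pairKernel 1 t * diagKernel 1 t) := by
  nontriviality A
  rw [← mul_assoc, ← det_projVandermonde_one_add_sq,
    ← det_eval_homogenize _ _ _ isMonicOfDegree_chebyshev_S, mul_comm, diagKernel,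
    ← Matrix.det_mul_column]
  congr 1
  ext i j
  have h_eval := one_sub_sq_mul_eval_homogenize_chebyshev_S (t i) j
  simp only [Matrix.of_apply]
  linear_combination (-t i ^ staircase n j) * h_eval

theorem det_sp_denominator (t : Fin n → A) :
    (Matrix.of fun i j : Fin n => if (j : ℕ) = 0 then t i ^ staircase n j
      else t i ^ staircase n j + t i ^ (staircase n j + 2 * (j : ℕ))).det =
        vandermonde t * pairKernel 1 t := by
  nontriviality A
  have h_monic (j : ℕ) : IsMonicOfDegree (if j = 0 then 1 else Chebyshev.C A j) j := by
    cases j with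
    | zero => simp
    | succ j => exact isMonicOfDegree_chebyshev_C j
  rw [← det_projVandermonde_one_add_sq, ← det_eval_homogenize _ _ _ h_monic]
  congr 1
  ext i j
  simp only [Matrix.of_apply]
  split_ifs with hj
  · simp [hj]
  · rw [eval_homogenize_chebyshev_C]
    ring

end WeylDenominators

/-! ### Schur polynomials as bialternants -/

section IntCoeff

variable {A B : Type*} [CommRing A] [CommRing B]

/-- The coefficients of a power series, extended by zero to negative indices. -/
noncomputable def intCoeff (u : PowerSeries A) (r : ℤ) : A :=
  if 0 ≤ r then PowerSeries.coeff r.toNat u else 0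

theorem intCoeff_natCast (u : PowerSeries A) (r : ℕ) : intCoeff u r = PowerSeries.coeff r u := by
  simp [intCoeff]

theorem intCoeff_of_neg (u : PowerSeries A) {r : ℤ} (hr : r < 0) : intCoeff u r = 0 :=
  if_neg hr.not_ge

theorem intCoeff_natCast_sub (u : PowerSeries A) (a m : ℕ) :
    intCoeff u ((a : ℤ) - m) = PowerSeries.coeff a (u * PowerSeries.X ^ m) := by
  rw [PowerSeries.coeff_mul_X_pow']
  split_ifs with hm
  · rw [← Nat.cast_sub hm, intCoeff_natCast]
  · exact intCoeff_of_neg u (by omega)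

theorem coeff_mul_polynomial (u : PowerSeries A) {p : Polynomial A} {n : ℕ} (hp : p.natDegree < n)
    (a : ℕ) :
    PowerSeries.coeff a (u * (p : PowerSeries A)) =
      ∑ m ∈ Finset.range n, p.coeff m * intCoeff u ((a : ℤ) - m) := by
  conv_lhs => rw [p.as_sum_range_C_mul_X_pow' hp]
  rw [← Polynomial.coeToPowerSeries.ringHom_apply, map_sum, Finset.mul_sum, map_sum]
  refine Finset.sum_congr rfl fun m _ => ?_
  simp [intCoeff_natCast_sub, mul_left_comm u]

theorem map_intCoeff (φ : A →+* B) (u : PowerSeries A) (r : ℤ) :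
    φ (intCoeff u r) = intCoeff (PowerSeries.map φ u) r := by
  rw [intCoeff, intCoeff, apply_ite φ, map_zero, PowerSeries.coeff_map]

end IntCoeff

section CompleteSeries

variable {ι A B : Type*} [Fintype ι] [CommRing A] [CommRing B]

/-- The generating series `∏ i, (1 - t_i X)⁻¹` of the complete homogeneous symmetric polynomials
in the variables `t`. -/
noncomputable def completeSeries (t : ι → A) : PowerSeries A :=
  PowerSeries.invOfUnit (∏ i, (1 - PowerSeries.C (t i) * PowerSeries.X)) 1

theorem completeSeries_mul_prod (t : ι → A) :
    completeSeries t * ∏ i, (1 - PowerSeries.C (t i) * PowerSeries.X) = 1 := by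
  rw [mul_comm]
  exact PowerSeries.mul_invOfUnit _ _ (by simp [map_prod])

theorem completeSeries_eq {t : ι → A} {F : PowerSeries A}
    (hF : F * ∏ i, (1 - PowerSeries.C (t i) * PowerSeries.X) = 1) : F = completeSeries t := by
  rw [← mul_one F, ← completeSeries_mul_prod t, mul_left_comm, hF, mul_one]

theorem map_completeSeries (φ : A →+* B) (t : ι → A) :
    PowerSeries.map φ (completeSeries t) = completeSeries fun i => φ (t i) := by
  refine completeSeries_eq ?_
  have h_map := congrArg (PowerSeries.map φ) (completeSeries_mul_prod t)
  simpa only [map_mul, map_prod, map_sub, map_one, PowerSeries.map_C, PowerSeries.map_X] using h_map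

theorem completeSeries_comp_perm (t : ι → A) (σ : Equiv.Perm ι) :
    completeSeries (t ∘ σ) = completeSeries t := by
  rw [completeSeries, completeSeries,
    ← Equiv.prod_comp σ fun i => 1 - PowerSeries.C (t i) * PowerSeries.X]
  rfl

theorem mk_pow_mul_one_sub (x : A) :
    (PowerSeries.mk fun r => x ^ r) * (1 - PowerSeries.C x * PowerSeries.X) = 1 := by
  have h_rescale :=
    congrArg (PowerSeries.rescale x) (PowerSeries.mk_one_mul_one_sub_eq_one A)
  simpa [PowerSeries.rescale_mk] using h_rescale

variable [DecidableEq ι]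

/-- The product `∏_{i ≠ k} (1 - t_i X)`, whose coefficients are, up to sign, the elementary
symmetric polynomials in the variables other than `t_k`. -/
noncomputable def elementaryErase (t : ι → A) (k : ι) : Polynomial A :=
  ∏ i ∈ Finset.univ.erase k, (1 - Polynomial.C (t i) * Polynomial.X)

theorem natDegree_elementaryErase_lt (t : ι → A) (k : ι) :
    (elementaryErase t k).natDegree < Fintype.card ι := by
  calc (elementaryErase t k).natDegree
      ≤ ∑ i ∈ Finset.univ.erase k, (1 - Polynomial.C (t i) * Polynomial.X).natDegree := by
        rw [elementaryErase]
        exact Polynomial.natDegree_prod_le _ _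
    _ ≤ (Finset.univ.erase k).card • 1 := by
        refine Finset.sum_le_card_nsmul _ _ _ fun i _ => ?_
        compute_degree
    _ < Fintype.card ι := by
        rw [smul_eq_mul, mul_one]
        exact Finset.card_erase_lt_of_mem (Finset.mem_univ k)

theorem completeSeries_mul_elementaryErase (t : ι → A) (k : ι) :
    completeSeries t * (elementaryErase t k : PowerSeries A) = PowerSeries.mk fun r => t k ^ r := by
  have h_prod : (elementaryErase t k : PowerSeries A) *
      (1 - PowerSeries.C (t k) * PowerSeries.X) =
        ∏ i, (1 - PowerSeries.C (t i) * PowerSeries.X) := by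
    rw [← Finset.prod_erase_mul _ _ (Finset.mem_univ k), elementaryErase,
      ← Polynomial.coeToPowerSeries.ringHom_apply, map_prod]
    simp
  calc completeSeries t * (elementaryErase t k : PowerSeries A)
      = completeSeries t * (elementaryErase t k : PowerSeries A) *
          ((PowerSeries.mk fun r => t k ^ r) * (1 - PowerSeries.C (t k) * PowerSeries.X)) := by
        rw [mk_pow_mul_one_sub, mul_one]
    _ = (PowerSeries.mk fun r => t k ^ r) * (completeSeries t *
          ((elementaryErase t k : PowerSeries A) * (1 - PowerSeries.C (t k) * PowerSeries.X))) := by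
        ring
    _ = PowerSeries.mk fun r => t k ^ r := by
        rw [h_prod, completeSeries_mul_prod, mul_one]

end CompleteSeries

section Bialternants

variable {A B : Type*} [CommRing A] [CommRing B] {n : ℕ}

/-- The Schur polynomial of `f` in the variables `t`, given by the Jacobi–Trudi determinant. -/
noncomputable def schur (t : Fin n → A) (f : Fin n → ℕ) : A :=
  Matrix.det (Matrix.of fun i j : Fin n =>
    intCoeff (completeSeries t) ((f i : ℤ) - (i : ℤ) + (j : ℤ)))

theorem map_schur (φ : A →+* B) (t : Fin n → A) (f : Fin n → ℕ) :
    φ (schur t f) = schur (fun i => φ (t i)) f := by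
  rw [schur, RingHom.map_det, schur]
  congr 1
  ext i j
  simp [map_intCoeff, map_completeSeries]

theorem schur_perm_comp (t : Fin n → A) (f : Fin n → ℕ) (σ : Equiv.Perm (Fin n)) :
    schur (t ∘ σ) f = schur t f := by
  rw [schur, completeSeries_comp_perm, schur]

theorem schur_zero (t : Fin n → A) : schur t 0 = 1 := by
  have h_one : intCoeff (completeSeries t) 0 = 1 := by
    simpa [completeSeries, PowerSeries.coeff_invOfUnit] using
      intCoeff_natCast (completeSeries t) 0
  rw [schur, Matrix.det_of_isUpperTriangular]
  · simp [h_one]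
  · intro i j hij
    simp only [id, Fin.lt_def] at hij
    rw [Matrix.of_apply, intCoeff_of_neg]
    simp only [Pi.zero_apply, Nat.cast_zero]
    omega

theorem pow_eq_sum_elementaryErase (t : Fin n → A) (k : Fin n) (a : ℕ) :
    t k ^ a = ∑ j : Fin n, (elementaryErase t k).coeff (staircase n j) *
      intCoeff (completeSeries t) ((a : ℤ) - staircase n j) := by
  have h_coeff := congrArg (PowerSeries.coeff a) (completeSeries_mul_elementaryErase t k)
  rw [coeff_mul_polynomial _ ((natDegree_elementaryErase_lt t k).trans_eq (Fintype.card_fin n)),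
    PowerSeries.coeff_mk, ← Fin.sum_univ_eq_sum_range fun m =>
      (elementaryErase t k).coeff m * intCoeff (completeSeries t) ((a : ℤ) - m)] at h_coeff
  rw [← h_coeff]
  exact (Equiv.sum_comp Fin.revPerm fun j : Fin n => (elementaryErase t k).coeff j *
    intCoeff (completeSeries t) ((a : ℤ) - (j : ℕ))).symm

theorem alternant_eq_det_mul_schur (t : Fin n → A) (f : Fin n → ℕ) :
    alternant t (fun i => f i + staircase n i) =
      (Matrix.of fun k j : Fin n => (elementaryErase t k).coeff (staircase n j)).det *
        schur t f := by
  rw [schur, ← Matrix.det_transpose (Matrix.of fun i j : Fin n => intCoeff _ _),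
    ← Matrix.det_mul, alternant]
  congr 1
  ext k i
  rw [Matrix.of_apply, pow_eq_sum_elementaryErase, Matrix.mul_apply]
  refine Finset.sum_congr rfl fun j _ => ?_
  have h_index : ((f i + staircase n i : ℕ) : ℤ) - staircase n j = f i - (i : ℕ) + (j : ℕ) := by
    simp only [staircase_apply]
    omega
  rw [h_index, Matrix.transpose_apply, Matrix.of_apply, Matrix.of_apply]

theorem alternant_add_staircase (t : Fin n → A) (f : Fin n → ℕ) :
    alternant t (fun i => f i + staircase n i) = vandermonde t * schur t f := by
  have h_zero := alternant_eq_det_mul_schur t 0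
  simp only [schur_zero, mul_one, Pi.zero_apply, zero_add] at h_zero
  rw [alternant_eq_det_mul_schur, ← h_zero, vandermonde]

end Bialternants

/-! ### Partitions and exponents -/

section Diagrams

variable {n d : ℕ} {μ ν : YoungDiagram}

/-- The first `n` parts of a partition. -/
def rowTuple (n : ℕ) (μ : YoungDiagram) : Fin n → ℕ := fun i => μ.rowLen i

/-- The exponents `λ + δ` of the alternant that belongs to a partition `λ` with at most `n`
parts. -/
def shiftedRows (n : ℕ) (μ : YoungDiagram) : Fin n → ℕ := fun i => rowTuple n μ i + staircase n i

theorem antitone_rowTuple (n : ℕ) (μ : YoungDiagram) : Antitone (rowTuple n μ) :=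
  fun i j hij => μ.rowLen_anti i j hij

theorem rowLen_eq_zero {i : ℕ} (hi : μ.colLen 0 ≤ i) : μ.rowLen i = 0 := by
  rw [← Nat.le_zero, ← not_lt, ← YoungDiagram.mem_iff_lt_rowLen, YoungDiagram.mem_iff_lt_colLen]
  exact hi.not_gt

theorem colLen_eq_card_rowTuple (hμ : μ.colLen 0 ≤ n) (j : ℕ) :
    μ.colLen j = (Finset.univ.filter fun i => j < rowTuple n μ i).card := by
  have h_filter (i : Fin n) : j < rowTuple n μ i ↔ (i : ℕ) < μ.colLen j := by
    rw [rowTuple, ← YoungDiagram.mem_iff_lt_rowLen, YoungDiagram.mem_iff_lt_colLen]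
  simp_rw [h_filter]
  rw [Fin.card_filter_val_lt, min_eq_right ((μ.colLen_anti 0 j j.zero_le).trans hμ)]

theorem sum_rowTuple (hμ : μ.colLen 0 ≤ n) : ∑ i, rowTuple n μ i = μ.card := by
  have h_row : ∀ c ∈ μ.cells, c.1 ∈ Finset.range n := by
    rintro ⟨i, j⟩ hc
    have h_first : (i, 0) ∈ μ := μ.up_left_mem le_rfl j.zero_le hc
    rw [YoungDiagram.mem_iff_lt_colLen] at h_first
    exact Finset.mem_range.2 (h_first.trans_le hμ)
  rw [YoungDiagram.card, Finset.card_eq_sum_card_fiberwise h_row, ← Fin.sum_univ_eq_sum_range]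
  refine Finset.sum_congr rfl fun i _ => ?_
  rw [rowTuple, YoungDiagram.rowLen_eq_card]
  rfl

theorem sum_shiftedRows (hμ : μ.colLen 0 ≤ n) :
    ∑ i, shiftedRows n μ i = μ.card + ∑ i, staircase n i := by
  simp only [shiftedRows, Finset.sum_add_distrib, sum_rowTuple hμ]

theorem colLen_zero_le_card (μ : YoungDiagram) : μ.colLen 0 ≤ μ.card := by
  rw [YoungDiagram.colLen_eq_card]
  exact Finset.card_le_card (Finset.filter_subset _ _)

theorem rowTuple_injOn (n : ℕ) : Set.InjOn (rowTuple n) {μ | μ.colLen 0 ≤ n} := by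
  intro μ hμ ν hν h
  have h_row (i : ℕ) : μ.rowLen i = ν.rowLen i := by
    obtain hi | hi := lt_or_ge i n
    · exact congrFun h ⟨i, hi⟩
    · rw [rowLen_eq_zero (le_trans hμ hi), rowLen_eq_zero (le_trans hν hi)]
  refine SetLike.ext fun ⟨i, j⟩ => ?_
  rw [YoungDiagram.mem_iff_lt_rowLen, YoungDiagram.mem_iff_lt_rowLen, h_row]

theorem shiftedRows_injOn (n : ℕ) : Set.InjOn (shiftedRows n) {μ | μ.colLen 0 ≤ n} :=
  fun _ hμ _ hν h =>
    rowTuple_injOn n hμ hν (funext fun i => Nat.add_right_cancel (congrFun h i))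

theorem exists_rowTuple_eq {f : Fin n → ℕ} (hf : Antitone f) :
    ∃ μ : YoungDiagram, μ.colLen 0 ≤ n ∧ rowTuple n μ = f := by
  have h_sorted : (List.ofFn f).SortedGE := List.sortedGE_ofFn_iff.2 hf
  refine ⟨YoungDiagram.ofRowLens (List.ofFn f) h_sorted, ?_, funext fun i => ?_⟩
  · rw [← not_lt, ← YoungDiagram.mem_iff_lt_colLen, YoungDiagram.mem_ofRowLens]
    simp
  · simpa [rowTuple] using YoungDiagram.rowLen_ofRowLens (hw := h_sorted) ⟨i, by simp⟩

theorem strictAnti_shiftedRows (n : ℕ) (μ : YoungDiagram) : StrictAnti (shiftedRows n μ) :=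
  fun _ _ hij => Nat.add_lt_add_of_le_of_lt (antitone_rowTuple n μ hij.le) (Fin.rev_lt_rev.2 hij)

theorem staircase_le_of_strictAnti {m : Fin n → ℕ} (hm : StrictAnti m) (i : Fin n) :
    staircase n i ≤ m i := by
  have h_card : (Finset.Ioi i).card ≤ (Finset.range (m i)).card :=
    Finset.card_le_card_of_injOn m
      (fun j hj => by simpa using hm (by simpa using hj)) hm.injective.injOn
  rwa [Fin.card_Ioi, Finset.card_range, ← staircase_apply] at h_card

theorem antitone_sub_staircase {m : Fin n → ℕ} (hm : StrictAnti m) :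
    Antitone fun i => m i - staircase n i := by
  intro i j hij
  have h_card : (Finset.Ico i j).card ≤ (Finset.Ioc (m j) (m i)).card :=
    Finset.card_le_card_of_injOn m (fun k hk => by
      simp only [Finset.coe_Ico, Set.mem_Ico, Finset.coe_Ioc, Set.mem_Ioc] at hk ⊢
      exact ⟨hm hk.2, hm.antitone hk.1⟩) hm.injective.injOn
  rw [Fin.card_Ico, Nat.card_Ioc] at h_card
  have h_le := hm.antitone hij
  rw [Fin.le_def] at hij
  simp only [staircase_apply]
  omega

theorem exists_shiftedRows_eq {m : Fin n → ℕ} (hm : StrictAnti m) :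
    ∃ μ : YoungDiagram, μ.colLen 0 ≤ n ∧ shiftedRows n μ = m := by
  obtain ⟨μ, hμ, h_rows⟩ := exists_rowTuple_eq (antitone_sub_staircase hm)
  refine ⟨μ, hμ, funext fun i => ?_⟩
  rw [shiftedRows, h_rows]
  exact Nat.sub_add_cancel (staircase_le_of_strictAnti hm i)

theorem mem_evenRows_iff (hμ : μ.colLen 0 ≤ n) :
    μ ∈ evenRows ↔ rowTuple n μ ∈ evenRowTuples n := by
  refine ⟨fun h => ⟨antitone_rowTuple n μ, fun i => h i⟩, fun h i => ?_⟩
  obtain hi | hi := lt_or_ge i n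
  · exact h.2 ⟨i, hi⟩
  · rw [rowLen_eq_zero (hμ.trans hi)]
    exact Even.zero

theorem mem_evenCols_iff (hμ : μ.colLen 0 ≤ n) :
    μ ∈ evenCols ↔ rowTuple n μ ∈ evenColTuples n := by
  rw [evenColTuples, Set.mem_ofPred_eq, and_iff_right (antitone_rowTuple n μ)]
  exact forall_congr' fun j => by rw [colLen_eq_card_rowTuple hμ]

theorem finite_setOf_card_eq (d : ℕ) : {μ : YoungDiagram | μ.card = d}.Finite := by
  have h_subset : {μ : YoungDiagram | μ.card = d} ⊆ {μ | μ.colLen 0 ≤ d} :=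
    fun μ hμ => (colLen_zero_le_card μ).trans hμ.le
  refine Set.Finite.of_finite_image ?_ ((rowTuple_injOn d).mono h_subset)
  refine (Finset.piAntidiag Finset.univ d).finite_toSet.subset ?_
  rintro _ ⟨μ, hμ, rfl⟩
  simpa [sum_rowTuple (h_subset hμ)] using hμ

/-- The partitions of `d`. -/
noncomputable def parts (d : ℕ) : Finset YoungDiagram := (finite_setOf_card_eq d).toFinset

theorem mem_parts : μ ∈ parts d ↔ μ.card = d := by simp [parts]

theorem colLen_zero_le_of_mem_parts (hd : d ≤ n) (hμ : μ ∈ parts d) : μ.colLen 0 ≤ n :=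
  (colLen_zero_le_card μ).trans ((mem_parts.1 hμ).trans_le hd)

open scoped Classical in
theorem coeff_alternantSeries_eq_sum_parts {A : Type*} [CommRing A] (t : Fin n → A) (hd : d ≤ n)
    {S : Set (Fin n → ℕ)} (hS : ∀ f ∈ S, Antitone f) {Q : Set YoungDiagram}
    (hQ : ∀ μ : YoungDiagram, μ.colLen 0 ≤ n → (μ ∈ Q ↔ rowTuple n μ ∈ S)) :
    PowerSeries.coeff d (alternantSeries t S) =
      ∑ μ ∈ parts d with μ ∈ Q, alternant t (shiftedRows n μ) := by
  rw [coeff_alternantSeries]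
  symm
  refine Finset.sum_bij (fun μ _ => rowTuple n μ) ?_ ?_ ?_ fun _ _ => rfl
  · intro μ hμ
    rw [Finset.mem_filter] at hμ ⊢
    have h_le := colLen_zero_le_of_mem_parts hd hμ.1
    refine ⟨?_, (hQ μ h_le).1 hμ.2⟩
    simpa [sum_rowTuple h_le] using mem_parts.1 hμ.1
  · intro μ hμ ν hν
    rw [Finset.mem_filter] at hμ hν
    exact rowTuple_injOn n (colLen_zero_le_of_mem_parts hd hμ.1)
      (colLen_zero_le_of_mem_parts hd hν.1)
  · intro f hf
    rw [Finset.mem_filter, Finset.mem_piAntidiag] at hf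
    obtain ⟨μ, hμ, rfl⟩ := exists_rowTuple_eq (hS f hf.2)
    refine ⟨μ, Finset.mem_filter.2 ⟨mem_parts.2 ?_, (hQ μ hμ).2 hf.2⟩, rfl⟩
    exact (sum_rowTuple hμ).symm.trans hf.1.1

open scoped Classical in
theorem coeff_alternantSeries_eq_vandermonde_mul_sum_schur {A : Type*} [CommRing A] (t : Fin n → A)
    (hd : d ≤ n) {S : Set (Fin n → ℕ)} (hS : ∀ f ∈ S, Antitone f) {Q : Set YoungDiagram}
    (hQ : ∀ μ : YoungDiagram, μ.colLen 0 ≤ n → (μ ∈ Q ↔ rowTuple n μ ∈ S)) :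
    PowerSeries.coeff d (alternantSeries t S) =
      vandermonde t * ∑ μ ∈ parts d with μ ∈ Q, schur t (rowTuple n μ) := by
  rw [coeff_alternantSeries_eq_sum_parts t hd hS hQ, Finset.mul_sum]
  exact Finset.sum_congr rfl fun μ _ => alternant_add_staircase t _

end Diagrams

/-! ### Alternating power series -/

section InVar

variable {R σ τ : Type*} [CommSemiring R]

/-- A power series in one variable, viewed as a series in the variable `X i`. -/
noncomputable def inVar (i : σ) : PowerSeries R →ₐ[R] MvPowerSeries σ R :=
  MvPowerSeries.rename (⟨fun _ => i, Function.injective_of_subsingleton _⟩ : Unit ↪ σ)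

theorem inVar_X (i : σ) : inVar i (PowerSeries.X : PowerSeries R) = MvPowerSeries.X i :=
  MvPowerSeries.rename_X _ _

theorem coeff_single_inVar (i : σ) (u : PowerSeries R) (k : ℕ) :
    MvPowerSeries.coeff (Finsupp.single i k) (inVar i u) = PowerSeries.coeff k u := by
  have h_coeff := MvPowerSeries.coeff_embDomain_rename
    (⟨fun _ => i, Function.injective_of_subsingleton _⟩ : Unit ↪ σ) u (Finsupp.single () k)
  rwa [Finsupp.embDomain_single] at h_coeff

theorem coeff_inVar_eq_zero (i : σ) (u : PowerSeries R) {m : σ →₀ ℕ}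
    (hm : m ≠ Finsupp.single i (m i)) : MvPowerSeries.coeff m (inVar i u) = 0 := by
  refine MvPowerSeries.coeff_rename_eq_zero (R := R) _ (p := u) ?_
  rintro ⟨x, rfl⟩
  apply hm
  have hx : x = Finsupp.single () (x ()) := by
    ext
    simp
  rw [hx, Finsupp.mapDomain_single]
  exact congrArg _ Finsupp.single_eq_same.symm

variable [Fintype σ]

/-- The coefficient of a power series at an exponent that is given as a function. -/
noncomputable def tupleCoeff (α : σ → ℕ) : MvPowerSeries σ R →ₗ[R] R :=
  MvPowerSeries.coeff (Finsupp.equivFunOnFinite.symm α)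

theorem ext_tupleCoeff {f g : MvPowerSeries σ R} (h : ∀ α, tupleCoeff α f = tupleCoeff α g) :
    f = g := by
  ext m
  simpa [tupleCoeff] using h m

theorem tupleCoeff_rename (e : Equiv.Perm σ) (f : MvPowerSeries σ R) (α : σ → ℕ) :
    tupleCoeff α (MvPowerSeries.rename e f) = tupleCoeff (α ∘ e) f := by
  have h_embDomain : (Finsupp.equivFunOnFinite.symm α : σ →₀ ℕ) =
      Finsupp.embDomain e.toEmbedding (Finsupp.equivFunOnFinite.symm (α ∘ e)) := by
    ext i
    obtain ⟨j, rfl⟩ := e.surjective i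
    exact (Finsupp.embDomain_apply_self e.toEmbedding
      (Finsupp.equivFunOnFinite.symm (α ∘ e)) j).symm
  rw [tupleCoeff, h_embDomain]
  exact MvPowerSeries.coeff_embDomain_rename e.toEmbedding f _

theorem tupleCoeff_prod_inVar (u : σ → PowerSeries R) (α : σ → ℕ) :
    tupleCoeff α (∏ i, inVar i (u i)) = ∏ i, PowerSeries.coeff (α i) (u i) := by
  classical
  rw [tupleCoeff, MvPowerSeries.coeff_prod, Finset.sum_eq_single
    (Finsupp.equivFunOnFinite.symm fun i => Finsupp.single i (α i))]
  · simp [coeff_single_inVar]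
  · intro l hl hne
    rw [Finset.mem_finsuppAntidiag] at hl
    by_contra h_ne_zero
    have h_single (i : σ) : l i = Finsupp.single i (l i i) := by
      by_contra hi
      exact h_ne_zero (Finset.prod_eq_zero (Finset.mem_univ i) (coeff_inVar_eq_zero i _ hi))
    have h_diag (j : σ) : l j j = α j := by
      have h_sum := DFunLike.congr_fun hl.1 j
      rwa [Finsupp.finsetSum_apply, Finset.sum_eq_single j
        (fun i _ hij => by rw [h_single i, Finsupp.single_eq_of_ne hij.symm]) (by simp)] at h_sum
    apply hne
    ext i : 1
    rw [h_single i, h_diag i]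
    rfl
  · intro h_notMem
    refine absurd (Finset.mem_finsuppAntidiag.2 ⟨?_, Finset.subset_univ _⟩) h_notMem
    ext j
    simp [Finsupp.finsetSum_apply, Finsupp.single_apply]

end InVar

section Alternating

variable {R : Type*} [CommRing R] {n : ℕ}

theorem tupleCoeff_det_inVar (u : Fin n → PowerSeries R) (α : Fin n → ℕ) :
    tupleCoeff α (Matrix.det (Matrix.of fun i j => inVar i (u j))) =
      Matrix.det (Matrix.of fun i j => PowerSeries.coeff (α i) (u j)) := by
  rw [← Matrix.det_transpose, Matrix.det_apply, ← Matrix.det_transpose, Matrix.det_apply, map_sum]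
  refine Finset.sum_congr rfl fun σ _ => ?_
  simp only [Matrix.transpose_apply, Matrix.of_apply]
  rw [← tupleCoeff_prod_inVar, Units.smul_def, Units.smul_def, map_zsmul]

/-- Power series that change by the sign of a permutation when their variables are permuted. -/
def IsAlternating (f : MvPowerSeries (Fin n) R) : Prop :=
  ∀ e : Equiv.Perm (Fin n), MvPowerSeries.rename e f = (Equiv.Perm.sign e : ℤ) • f

theorem isAlternating_iff_tupleCoeff {f : MvPowerSeries (Fin n) R} :
    IsAlternating f ↔ ∀ (e : Equiv.Perm (Fin n)) (α : Fin n → ℕ),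
      tupleCoeff (α ∘ e) f = (Equiv.Perm.sign e : ℤ) * tupleCoeff α f := by
  refine forall_congr' fun e => ⟨fun h α => ?_, fun h => ext_tupleCoeff fun α => ?_⟩
  · rw [← tupleCoeff_rename, h, map_zsmul, zsmul_eq_mul]
  · rw [tupleCoeff_rename, h, map_zsmul, zsmul_eq_mul]

theorem isAlternating_det_inVar (u : Fin n → PowerSeries R) :
    IsAlternating (Matrix.det (Matrix.of fun i j => inVar i (u j))) := by
  refine isAlternating_iff_tupleCoeff.2 fun e α => ?_
  rw [tupleCoeff_det_inVar, tupleCoeff_det_inVar, ← Matrix.det_permute]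
  rfl

theorem alternant_X_eq_det_inVar (β : Fin n → ℕ) :
    alternant (MvPowerSeries.X : Fin n → MvPowerSeries (Fin n) R) β =
      Matrix.det (Matrix.of fun i j => inVar i (PowerSeries.X ^ β j)) := by
  simp only [alternant, map_pow, inVar_X]

theorem isAlternating_alternant_X_mul_schur (α β : Fin n → ℕ) :
    IsAlternating (alternant (MvPowerSeries.X : Fin n → MvPowerSeries (Fin n) R) α *
      schur MvPowerSeries.X β) := by
  intro e
  have h_rename : (fun i => (MvPowerSeries.rename (R := R) e).toRingHom (MvPowerSeries.X i)) =
      MvPowerSeries.X ∘ e :=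
    funext fun i => MvPowerSeries.rename_X e i
  change (MvPowerSeries.rename (R := R) e).toRingHom _ = _
  rw [map_mul, map_alternant, map_schur, h_rename, alternant_perm_comp, schur_perm_comp,
    zsmul_eq_mul, mul_assoc]

namespace IsAlternating

variable {f g : MvPowerSeries (Fin n) R}

theorem sub (hf : IsAlternating f) (hg : IsAlternating g) : IsAlternating (f - g) := fun e => by
  rw [map_sub, hf, hg, smul_sub]

theorem sum {ι : Type*} {s : Finset ι} {f : ι → MvPowerSeries (Fin n) R}
    (hf : ∀ i ∈ s, IsAlternating (f i)) : IsAlternating (∑ i ∈ s, f i) := fun e => by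
  rw [map_sum, Finset.smul_sum]
  exact Finset.sum_congr rfl fun i hi => hf i hi e

theorem smul (hf : IsAlternating f) (c : R) : IsAlternating (c • f) := fun e => by
  rw [map_smul, hf, smul_comm]

theorem tupleCoeff_eq_zero [IsDomain R] [CharZero R] (hf : IsAlternating f) {α : Fin n → ℕ}
    (hα : ¬ Function.Injective α) : tupleCoeff α f = 0 := by
  rw [Function.not_injective_iff] at hα
  obtain ⟨i, j, hij, hne⟩ := hα
  have h_swap : α ∘ Equiv.swap i j = α := by
    ext k
    rw [Function.comp_apply, Equiv.swap_apply_def]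
    split_ifs with hki hkj
    · rw [hki, hij]
    · rw [hkj, hij]
    · rfl
  have h_neg := isAlternating_iff_tupleCoeff.1 hf (Equiv.swap i j) α
  rw [h_swap, Equiv.Perm.sign_swap hne] at h_neg
  simpa [self_eq_neg] using h_neg

theorem eq_zero [IsDomain R] [CharZero R] (hf : IsAlternating f)
    (h : ∀ μ : YoungDiagram, μ.colLen 0 ≤ n → tupleCoeff (shiftedRows n μ) f = 0) : f = 0 := by
  refine ext_tupleCoeff fun α => ?_
  rw [map_zero]
  by_cases hα : Function.Injective α
  · let e := Tuple.sort (OrderDual.toDual ∘ α)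
    have h_antitone : Antitone (α ∘ e) :=
      fun i j hij => Tuple.monotone_sort (OrderDual.toDual ∘ α) hij
    obtain ⟨μ, hμ, h_shifted⟩ :=
      exists_shiftedRows_eq (h_antitone.strictAnti_of_injective (hα.comp e.injective))
    have h_zero := h μ hμ
    rw [h_shifted, isAlternating_iff_tupleCoeff.1 hf] at h_zero
    obtain h_sign | h_sign := Int.units_eq_one_or (Equiv.Perm.sign e)
    · simpa [h_sign] using h_zero
    · simpa [h_sign] using h_zero
  · exact hf.tupleCoeff_eq_zero hα

theorem ext [IsDomain R] [CharZero R] (hf : IsAlternating f) (hg : IsAlternating g)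
    (h : ∀ μ : YoungDiagram, μ.colLen 0 ≤ n →
      tupleCoeff (shiftedRows n μ) f = tupleCoeff (shiftedRows n μ) g) : f = g :=
  sub_eq_zero.1 ((hf.sub hg).eq_zero fun μ hμ => by rw [map_sub, h μ hμ, sub_self])

end IsAlternating

theorem isAlternating_alternant_X (β : Fin n → ℕ) :
    IsAlternating (alternant (MvPowerSeries.X : Fin n → MvPowerSeries (Fin n) R) β) := by
  rw [alternant_X_eq_det_inVar]
  exact isAlternating_det_inVar _

theorem tupleCoeff_alternant_self {β : Fin n → ℕ} (hβ : Function.Injective β) :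
    tupleCoeff β (alternant (MvPowerSeries.X : Fin n → MvPowerSeries (Fin n) R) β) = 1 := by
  rw [alternant_X_eq_det_inVar, tupleCoeff_det_inVar, ← Matrix.det_one (n := Fin n)]
  congr 1
  ext i j
  simp [PowerSeries.coeff_X_pow, Matrix.one_apply, hβ.eq_iff]

theorem tupleCoeff_alternant_of_notMem_range {α β : Fin n → ℕ} {i : Fin n}
    (hi : α i ∉ Set.range β) :
    tupleCoeff α (alternant (MvPowerSeries.X : Fin n → MvPowerSeries (Fin n) R) β) = 0 := by
  rw [alternant_X_eq_det_inVar, tupleCoeff_det_inVar]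
  refine Matrix.det_eq_zero_of_row_eq_zero i fun j => ?_
  rw [Matrix.of_apply, PowerSeries.coeff_X_pow, if_neg fun h => hi ⟨j, h.symm⟩]

theorem exists_notMem_range_of_strictAnti {α β : Fin n → ℕ} (hα : StrictAnti α)
    (hβ : StrictAnti β) (hne : α ≠ β) : ∃ i, α i ∉ Set.range β := by
  by_contra! h_mem
  choose g hg using h_mem
  have hg_injective : Function.Injective g := fun i j hij =>
    hα.injective (by rw [← hg, ← hg, hij])
  refine hne ((StrictAnti.range_inj hα hβ).1 (Set.Subset.antisymm ?_ ?_))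
  · rintro _ ⟨i, rfl⟩
    exact ⟨g i, hg i⟩
  · rintro _ ⟨j, rfl⟩
    obtain ⟨i, rfl⟩ := Finite.injective_iff_surjective.1 hg_injective j
    exact ⟨i, (hg i).symm⟩

theorem tupleCoeff_shiftedRows_alternant {μ ν : YoungDiagram} (hμ : μ.colLen 0 ≤ n)
    (hν : ν.colLen 0 ≤ n) [Decidable (μ = ν)] :
    tupleCoeff (shiftedRows n μ)
        (alternant (MvPowerSeries.X : Fin n → MvPowerSeries (Fin n) R) (shiftedRows n ν)) =
      if μ = ν then 1 else 0 := by
  split_ifs with h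
  · rw [h]
    exact tupleCoeff_alternant_self (strictAnti_shiftedRows n ν).injective
  · obtain ⟨i, hi⟩ := exists_notMem_range_of_strictAnti (strictAnti_shiftedRows n μ)
      (strictAnti_shiftedRows n ν) fun h_eq => h (shiftedRows_injOn n hμ hν h_eq)
    exact tupleCoeff_alternant_of_notMem_range hi

theorem vandermonde_X_ne_zero [Nontrivial R] :
    vandermonde (MvPowerSeries.X : Fin n → MvPowerSeries (Fin n) R) ≠ 0 := by
  intro h_zero
  have h_one := tupleCoeff_alternant_self (R := R) (β := staircase n) fun i j hij =>
    Fin.rev_injective (Fin.ext hij)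
  rw [← vandermonde, h_zero, map_zero] at h_one
  exact zero_ne_one h_one

end Alternating

/-! ### Homogeneous components -/

section Homogeneous

variable {R σ : Type*} [CommSemiring R]

theorem homogeneousComponent_mul (d : ℕ) (f g : MvPowerSeries σ R) :
    MvPowerSeries.homogeneousComponent d (f * g) =
      ∑ p ∈ Finset.HasAntidiagonal.antidiagonal d,
        MvPowerSeries.homogeneousComponent p.1 f * MvPowerSeries.homogeneousComponent p.2 g := by
  classical
  ext m
  rw [MvPowerSeries.coeff_homogeneousComponent, map_sum]
  simp_rw [MvPowerSeries.coeff_mul, MvPowerSeries.coeff_homogeneousComponent, ite_zero_mul_ite_zero]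
  rw [Finset.sum_comm]
  have h_term : ∀ q ∈ Finset.HasAntidiagonal.antidiagonal m,
      ∑ p ∈ Finset.HasAntidiagonal.antidiagonal d,
        (if q.1.degree = p.1 ∧ q.2.degree = p.2 then
          MvPowerSeries.coeff q.1 f * MvPowerSeries.coeff q.2 g else 0) =
      if m.degree = d then MvPowerSeries.coeff q.1 f * MvPowerSeries.coeff q.2 g else 0 := by
    intro q hq
    rw [Finset.HasAntidiagonal.mem_antidiagonal] at hq
    have h_mem : (q.1.degree, q.2.degree) ∈ Finset.HasAntidiagonal.antidiagonal d ↔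
        m.degree = d := by
      rw [Finset.HasAntidiagonal.mem_antidiagonal, ← hq, map_add]
    simp_rw [← h_mem, ← Prod.mk.injEq]
    exact Finset.sum_ite_eq _ _ _
  rw [Finset.sum_congr rfl h_term]
  split_ifs
  · rfl
  · exact Finset.sum_const_zero.symm

theorem homogeneousComponent_one (d : ℕ) :
    MvPowerSeries.homogeneousComponent d (1 : MvPowerSeries σ R) = if d = 0 then 1 else 0 := by
  classical
  ext m
  rw [MvPowerSeries.coeff_homogeneousComponent, apply_ite (MvPowerSeries.coeff m), map_zero,
    MvPowerSeries.coeff_one]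
  obtain rfl | hm := eq_or_ne m 0
  · simp only [map_zero, if_true, eq_comm]
  · simp only [hm, if_false, ite_self]

/-- The series `∑ f_d z^d`, where `f_d` is the homogeneous component of degree `d` of `f`; it
keeps track of degrees in products. -/
noncomputable def homogeneousSeries : MvPowerSeries σ R →+* PowerSeries (MvPowerSeries σ R) where
  toFun f := PowerSeries.mk fun d => MvPowerSeries.homogeneousComponent d f
  map_zero' := by
    ext
    simp
  map_one' := by
    ext1 d
    rw [PowerSeries.coeff_mk, homogeneousComponent_one, PowerSeries.coeff_one]
  map_add' f g := by
    ext
    simp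
  map_mul' f g := by
    ext1 d
    simp only [PowerSeries.coeff_mul, PowerSeries.coeff_mk, homogeneousComponent_mul]

theorem coeff_homogeneousSeries (f : MvPowerSeries σ R) (d : ℕ) :
    PowerSeries.coeff d (homogeneousSeries f) = MvPowerSeries.homogeneousComponent d f :=
  PowerSeries.coeff_mk d fun d => MvPowerSeries.homogeneousComponent d f

theorem homogeneousSeries_X (i : σ) :
    homogeneousSeries (MvPowerSeries.X i : MvPowerSeries σ R) =
      PowerSeries.C (MvPowerSeries.X i) * PowerSeries.X := by
  classical
  ext d m
  rw [coeff_homogeneousSeries, MvPowerSeries.coeff_homogeneousComponent, PowerSeries.coeff_C_mul,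
    PowerSeries.coeff_X, mul_ite, mul_one, mul_zero, apply_ite (MvPowerSeries.coeff m), map_zero,
    MvPowerSeries.coeff_X]
  obtain rfl | hm := eq_or_ne m (Finsupp.single i 1)
  · simp only [Finsupp.degree_single, eq_comm]
  · simp only [hm, if_false, ite_self]

end Homogeneous

section HomogeneousAlternating

variable {R : Type*} [CommRing R] {n : ℕ}

theorem alternant_mul_const {A : Type*} [CommRing A] (t : Fin n → A) (z : A) (α : Fin n → ℕ) :
    alternant (fun i => t i * z) α = alternant t α * z ^ ∑ j, α j := by
  rw [alternant, alternant, ← Finset.prod_pow_eq_pow_sum, mul_comm, ← Matrix.det_mul_row]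
  congr 1
  ext i j
  simp only [Matrix.of_apply, mul_pow, mul_comm]

theorem homogeneousSeries_alternant_X (α : Fin n → ℕ) :
    homogeneousSeries (alternant (MvPowerSeries.X : Fin n → MvPowerSeries (Fin n) R) α) =
      PowerSeries.C (alternant MvPowerSeries.X α) * PowerSeries.X ^ ∑ j, α j := by
  rw [map_alternant, map_alternant, ← alternant_mul_const]
  simp only [homogeneousSeries_X]

theorem homogeneousSeries_pairKernel :
    homogeneousSeries (pairKernel 1 (MvPowerSeries.X : Fin n → MvPowerSeries (Fin n) R)) =
      pairKernel (PowerSeries.X ^ 2) fun i => PowerSeries.C (MvPowerSeries.X i) := by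
  rw [map_pairKernel, pairKernel, pairKernel]
  congr 1
  ext1 i
  ext1 j
  rw [homogeneousSeries_X, homogeneousSeries_X, map_one]
  ring

theorem homogeneousSeries_diagKernel :
    homogeneousSeries (diagKernel 1 (MvPowerSeries.X : Fin n → MvPowerSeries (Fin n) R)) =
      diagKernel (PowerSeries.X ^ 2) fun i => PowerSeries.C (MvPowerSeries.X i) := by
  rw [map_diagKernel, diagKernel, diagKernel]
  refine Finset.prod_congr rfl fun i _ => ?_
  rw [homogeneousSeries_X, map_one]
  ring

theorem completeSeries_X_eq_homogeneousSeries :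
    completeSeries (MvPowerSeries.X : Fin n → MvPowerSeries (Fin n) R) =
      homogeneousSeries (∏ i, inVar i (PowerSeries.mk 1)) := by
  have h_factor (i : Fin n) : 1 - PowerSeries.C (MvPowerSeries.X i) * PowerSeries.X =
      homogeneousSeries (1 - MvPowerSeries.X i : MvPowerSeries (Fin n) R) := by
    rw [map_sub, map_one, homogeneousSeries_X]
  refine (completeSeries_eq ?_).symm
  simp only [h_factor]
  rw [← map_prod, ← map_mul, ← Finset.prod_mul_distrib]
  refine (congrArg homogeneousSeries (Finset.prod_eq_one fun i _ => ?_)).trans (map_one _)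
  rw [← inVar_X, ← map_one (inVar (R := R) i), ← map_sub, ← map_mul,
    PowerSeries.mk_one_mul_one_sub_eq_one]

theorem coeff_coeff_completeSeries_X (r : ℕ) (m : Fin n →₀ ℕ) :
    MvPowerSeries.coeff m (PowerSeries.coeff r
      (completeSeries (MvPowerSeries.X : Fin n → MvPowerSeries (Fin n) R))) =
        if m.degree = r then 1 else 0 := by
  have h_one : MvPowerSeries.coeff m (∏ i : Fin n, inVar i (PowerSeries.mk (1 : ℕ → R))) = 1 := by
    have h_prod := tupleCoeff_prod_inVar (fun _ : Fin n => PowerSeries.mk (1 : ℕ → R)) m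
    simpa [tupleCoeff] using h_prod
  rw [completeSeries_X_eq_homogeneousSeries, coeff_homogeneousSeries,
    MvPowerSeries.coeff_homogeneousComponent, h_one]

theorem tupleCoeff_homogeneousComponent {σ : Type*} [Fintype σ] (α : σ → ℕ) (a : ℕ)
    (f : MvPowerSeries σ R) :
    tupleCoeff α (MvPowerSeries.homogeneousComponent a f) =
      if ∑ i, α i = a then tupleCoeff α f else 0 := by
  rw [tupleCoeff, MvPowerSeries.coeff_homogeneousComponent, Finsupp.degree_eq_sum]
  rfl

namespace IsAlternating

variable {f : MvPowerSeries (Fin n) R}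

theorem homogeneousComponent (hf : IsAlternating f) (a : ℕ) :
    IsAlternating (MvPowerSeries.homogeneousComponent a f) := by
  rw [isAlternating_iff_tupleCoeff] at hf ⊢
  intro e α
  rw [tupleCoeff_homogeneousComponent, tupleCoeff_homogeneousComponent, hf, mul_ite, mul_zero]
  congr 2
  exact Equiv.sum_comp e α

variable [IsDomain R] [CharZero R]

theorem homogeneousComponent_eq_zero (hf : IsAlternating f) {a : ℕ} (ha : a < ∑ i, staircase n i) :
    MvPowerSeries.homogeneousComponent a f = 0 :=
  (hf.homogeneousComponent a).eq_zero fun μ hμ => by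
    rw [tupleCoeff_homogeneousComponent, sum_shiftedRows hμ, if_neg (by omega)]

theorem homogeneousComponent_eq_sum (hf : IsAlternating f) {a : ℕ} (ha : a ≤ n) :
    MvPowerSeries.homogeneousComponent (a + ∑ i, staircase n i) f =
      ∑ μ ∈ parts a,
        tupleCoeff (shiftedRows n μ) f • alternant MvPowerSeries.X (shiftedRows n μ) := by
  classical
  refine (hf.homogeneousComponent _).ext
    (sum fun ν _ => (isAlternating_alternant_X _).smul _) fun ρ hρ => ?_
  have h_term : ∀ ν ∈ parts a, tupleCoeff (shiftedRows n ρ) (tupleCoeff (shiftedRows n ν) f •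
      alternant MvPowerSeries.X (shiftedRows n ν)) =
        if ρ = ν then tupleCoeff (shiftedRows n ρ) f else 0 := by
    intro ν hν
    rw [map_smul, tupleCoeff_shiftedRows_alternant hρ (colLen_zero_le_of_mem_parts ha hν),
      smul_eq_mul, mul_ite, mul_one, mul_zero]
    split_ifs with h
    · rw [h]
    · rfl
  rw [map_sum, Finset.sum_congr rfl h_term, Finset.sum_ite_eq, tupleCoeff_homogeneousComponent,
    sum_shiftedRows hρ]
  simp only [mem_parts, Nat.add_right_cancel_iff]

theorem homogeneousSeries_eq (hf : IsAlternating f) :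
    homogeneousSeries f =
      (PowerSeries.mk fun a => MvPowerSeries.homogeneousComponent (a + ∑ i, staircase n i) f) *
        PowerSeries.X ^ ∑ i, staircase n i := by
  ext1 d
  rw [coeff_homogeneousSeries, PowerSeries.coeff_mul_X_pow']
  split_ifs with hd
  · rw [PowerSeries.coeff_mk, Nat.sub_add_cancel hd]
  · exact hf.homogeneousComponent_eq_zero (not_le.1 hd)

end IsAlternating

end HomogeneousAlternating

/-! ### Finitely many variables -/

section RestrictVars

variable {R : Type*} [CommRing R] {d n : ℕ}

/-- Setting all variables but the first `n` to zero. -/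
noncomputable def restrictVars (n : ℕ) : MvPowerSeries ℕ R →+* MvPowerSeries (Fin n) R :=
  (MvPowerSeries.killCompl (R := R) Fin.valEmbedding).toRingHom

theorem coeff_restrictVars (f : MvPowerSeries ℕ R) (m : Fin n →₀ ℕ) :
    MvPowerSeries.coeff m (restrictVars n f) =
      MvPowerSeries.coeff (Finsupp.embDomain Fin.valEmbedding m) f :=
  MvPowerSeries.coeff_killCompl _ _

theorem restrictVars_X (i : Fin n) :
    restrictVars n (MvPowerSeries.X (i : ℕ) : MvPowerSeries ℕ R) = MvPowerSeries.X i :=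
  MvPowerSeries.killCompl_X i

theorem restrictVars_X_of_le {i : ℕ} (hi : n ≤ i) :
    restrictVars n (MvPowerSeries.X i : MvPowerSeries ℕ R) = 0 := by
  refine MvPowerSeries.killCompl_X_eq_zero ?_
  rintro ⟨j, rfl⟩
  exact hi.not_gt j.is_lt

theorem restrictVars_eq_zero_of_le {f : MvPowerSeries ℕ R} (hdn : d ≤ n)
    (hf : restrictVars n f = 0) : restrictVars d f = 0 := by
  ext m
  have h_trans : Fin.valEmbedding = (Fin.castLEEmb hdn).trans Fin.valEmbedding := rfl
  rw [coeff_restrictVars, h_trans, Finsupp.embDomain_trans_apply, ← coeff_restrictVars, hf,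
    map_zero, map_zero]

theorem exists_embDomain_eq (N : ℕ) (m : ℕ →₀ ℕ) :
    ∃ n ≥ N, m ∈ Set.range (Finsupp.embDomain (Fin.valEmbedding (n := n)) (M := ℕ)) := by
  refine ⟨max N (m.support.sup id + 1), le_max_left _ _, ?_⟩
  rw [Finsupp.mem_range_embDomain_iff]
  intro i hi
  have h_lt : i < max N (m.support.sup id + 1) :=
    lt_max_of_lt_right (Nat.lt_succ_of_le (Finset.le_sup (f := id) hi))
  exact ⟨⟨i, h_lt⟩, rfl⟩

theorem eq_zero_of_forall_restrictVars_eq_zero {f : MvPowerSeries ℕ R} (N : ℕ)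
    (hf : ∀ n ≥ N, restrictVars n f = 0) : f = 0 := by
  ext m
  obtain ⟨n, hn, m, rfl⟩ := exists_embDomain_eq N m
  rw [← coeff_restrictVars, hf n hn, map_zero, map_zero]

end RestrictVars

section ToVars

variable {n : ℕ} {μ : YoungDiagram}

/-- Setting the variables `x_i` with `i ≥ n` of a symmetric function to zero. -/
noncomputable def toVars (n : ℕ) : Lam →+* MvPowerSeries (Fin n) ℤ :=
  (restrictVars n).comp Lam.subtype

theorem coeff_h (r : ℤ) (m : ℕ →₀ ℕ) :
    MvPowerSeries.coeff m (h r : MvPowerSeries ℕ ℤ) = if (m.degree : ℤ) = r then 1 else 0 :=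
  rfl

theorem h_zero : h 0 = 1 := by
  classical
  ext m
  rw [coeff_h, OneMemClass.coe_one, MvPowerSeries.coeff_one]
  simp only [Nat.cast_eq_zero, Finsupp.degree_eq_zero_iff]

theorem h_of_neg {r : ℤ} (hr : r < 0) : h r = 0 := by
  ext m
  rw [coeff_h, if_neg (by omega), ZeroMemClass.coe_zero, map_zero]

theorem toVars_h (n : ℕ) (r : ℤ) :
    toVars n (h r) = intCoeff (completeSeries MvPowerSeries.X) r := by
  obtain hr | hr := lt_or_ge r 0
  · rw [h_of_neg hr, intCoeff_of_neg _ hr, map_zero]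
  · obtain ⟨k, rfl⟩ := Int.eq_ofNat_of_zero_le hr
    ext m
    have h_degree : (Finsupp.embDomain Fin.valEmbedding m).degree = m.degree :=
      Finsupp.sum_embDomain (v := m) (f := Fin.valEmbedding) (g := fun _ x => x)
    rw [intCoeff_natCast, coeff_coeff_completeSeries_X, ← h_degree]
    refine (coeff_restrictVars _ _).trans ((coeff_h _ _).trans ?_)
    simp only [Nat.cast_inj]

theorem det_eq_det_of_le {R : Type*} [CommRing R] (g : ℕ → ℕ → R) {l n : ℕ} (hln : l ≤ n)
    (h_zero : ∀ i j, l ≤ i → j < i → g i j = 0) (h_one : ∀ i, l ≤ i → g i i = 1) :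
    (Matrix.of fun i j : Fin l => g i j).det = (Matrix.of fun i j : Fin n => g i j).det := by
  induction n, hln using Nat.le_induction with
  | base => rfl
  | succ n hln ih =>
    rw [ih, Matrix.det_succ_row (Matrix.of fun i j : Fin (n + 1) => g i j) (Fin.last n),
      Finset.sum_eq_single (Fin.last n)]
    · simp only [Matrix.of_apply, Fin.val_last, h_one n hln, mul_one, ← two_mul, pow_mul,
        neg_one_sq, one_pow, one_mul]
      congr 1
      ext i j
      simp
    · intro j _ hj
      simp [h_zero n j hln (Fin.val_lt_last hj)]
    · simp

theorem sGl_eq_det (hμ : μ.colLen 0 ≤ n) :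
    sGl μ = Matrix.det (Matrix.of fun i j : Fin n =>
      h ((μ.rowLen i : ℤ) - (i : ℤ) + (j : ℤ))) := by
  refine det_eq_det_of_le (fun i j => h ((μ.rowLen i : ℤ) - (i : ℤ) + (j : ℤ))) hμ
    (fun i j hi hj => ?_) fun i hi => ?_
  · rw [rowLen_eq_zero hi, h_of_neg (by omega)]
  · rw [rowLen_eq_zero hi, Nat.cast_zero, zero_sub, neg_add_cancel, h_zero]

theorem sSo_eq_det (hμ : μ.colLen 0 ≤ n) :
    sSo μ = Matrix.det (Matrix.of fun i j : Fin n =>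
      h ((μ.rowLen i : ℤ) - (i : ℤ) + (j : ℤ)) -
        h ((μ.rowLen i : ℤ) - (i : ℤ) - (j : ℤ) - 2)) := by
  refine det_eq_det_of_le (fun i j => h ((μ.rowLen i : ℤ) - (i : ℤ) + (j : ℤ)) -
    h ((μ.rowLen i : ℤ) - (i : ℤ) - (j : ℤ) - 2)) hμ (fun i j hi hj => ?_) fun i hi => ?_
  · rw [rowLen_eq_zero hi, h_of_neg (by omega), h_of_neg (by omega), sub_zero]
  · rw [rowLen_eq_zero hi, h_of_neg (r := ((0 : ℕ) : ℤ) - i - i - 2) (by omega), Nat.cast_zero,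
      zero_sub, neg_add_cancel, h_zero, sub_zero]

theorem sSp_eq_det (hμ : μ.colLen 0 ≤ n) :
    sSp μ = Matrix.det (Matrix.of fun i j : Fin n =>
      if (j : ℕ) = 0 then h ((μ.rowLen i : ℤ) - (i : ℤ))
      else h ((μ.rowLen i : ℤ) - (i : ℤ) + (j : ℤ)) +
        h ((μ.rowLen i : ℤ) - (i : ℤ) - (j : ℤ))) := by
  refine det_eq_det_of_le (fun i j => if j = 0 then h ((μ.rowLen i : ℤ) - (i : ℤ))
      else h ((μ.rowLen i : ℤ) - (i : ℤ) + (j : ℤ)) +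
        h ((μ.rowLen i : ℤ) - (i : ℤ) - (j : ℤ))) hμ (fun i j hi hj => ?_) fun i hi => ?_
  · simp only [rowLen_eq_zero hi]
    split_ifs
    · rw [h_of_neg (by omega)]
    · rw [h_of_neg (by omega), h_of_neg (by omega), add_zero]
  · simp only [rowLen_eq_zero hi, Nat.cast_zero, zero_sub, neg_add_cancel, h_zero]
    split_ifs with hi_zero
    · rw [hi_zero, Nat.cast_zero, neg_zero, h_zero]
    · rw [h_of_neg (by omega), add_zero]

theorem toVars_sGl (hμ : μ.colLen 0 ≤ n) :
    toVars n (sGl μ) = schur MvPowerSeries.X (rowTuple n μ) := by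
  rw [sGl_eq_det hμ, RingHom.map_det, schur]
  congr 1
  ext1 i j
  simp [toVars_h, rowTuple]

theorem vandermonde_mul_toVars_sGl (hμ : μ.colLen 0 ≤ n) :
    vandermonde MvPowerSeries.X * toVars n (sGl μ) =
      alternant MvPowerSeries.X (shiftedRows n μ) := by
  rw [toVars_sGl hμ, ← alternant_add_staircase]
  rfl

end ToVars

/-! ### Littlewood–Richardson coefficients -/

section LittlewoodRichardson

variable {n : ℕ} {μ γ ν : YoungDiagram}

theorem homogeneousComponent_alternant_mul_schur {R : Type*} [CommRing R] [IsDomain R]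
    (hμ : μ.colLen 0 ≤ n) (hγ : γ.colLen 0 ≤ n) :
    MvPowerSeries.homogeneousComponent (μ.card + γ.card + ∑ i, staircase n i)
        (alternant (MvPowerSeries.X : Fin n → MvPowerSeries (Fin n) R) (shiftedRows n μ) *
          schur MvPowerSeries.X (rowTuple n γ)) =
      alternant MvPowerSeries.X (shiftedRows n μ) * schur MvPowerSeries.X (rowTuple n γ) := by
  let F := alternant (MvPowerSeries.X : Fin n → MvPowerSeries (Fin n) R) (shiftedRows n μ) *
    schur MvPowerSeries.X (rowTuple n γ)
  have h_product : F * vandermonde MvPowerSeries.X =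
      alternant MvPowerSeries.X (shiftedRows n μ) *
        alternant MvPowerSeries.X (shiftedRows n γ) := by
    rw [mul_right_comm, mul_assoc, ← alternant_add_staircase]
    rfl
  have h_series : homogeneousSeries F =
      PowerSeries.C F * PowerSeries.X ^ (μ.card + γ.card + ∑ i, staircase n i) := by
    refine mul_right_cancel₀ (b := homogeneousSeries (vandermonde MvPowerSeries.X)) ?_ ?_
    · rw [vandermonde, homogeneousSeries_alternant_X]
      refine mul_ne_zero ?_ (pow_ne_zero _ PowerSeries.X_ne_zero)
      exact (map_ne_zero_iff _ PowerSeries.C_injective).2 vandermonde_X_ne_zero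
    · rw [← map_mul, h_product, map_mul, homogeneousSeries_alternant_X,
        homogeneousSeries_alternant_X, mul_mul_mul_comm, ← map_mul, ← h_product, vandermonde,
        homogeneousSeries_alternant_X, map_mul, sum_shiftedRows hμ, sum_shiftedRows hγ]
      ring
  rw [← coeff_homogeneousSeries]
  change PowerSeries.coeff _ (homogeneousSeries F) = F
  rw [h_series, PowerSeries.coeff_C_mul, PowerSeries.coeff_X_pow_self, mul_one]

/-- The coefficient of `a_{ν + δ}` in `a_δ f(x_1, …, x_n)`, that is, the coefficient of the Schur
polynomial of `ν` in the expansion of `f(x_1, …, x_n)`. -/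
noncomputable def schurCoeff (n : ℕ) (ν : YoungDiagram) : Lam →+ ℤ :=
  (tupleCoeff (shiftedRows n ν)).toAddMonoidHom.comp <|
    (AddMonoidHom.mulLeft (vandermonde MvPowerSeries.X)).comp (toVars n).toAddMonoidHom

theorem schurCoeff_apply (n : ℕ) (ν : YoungDiagram) (f : Lam) :
    schurCoeff n ν f =
      tupleCoeff (shiftedRows n ν) (vandermonde MvPowerSeries.X * toVars n f) :=
  rfl

theorem schurCoeff_congr {f g : Lam} (hfg : toVars n f = toVars n g) (ν : YoungDiagram) :
    schurCoeff n ν f = schurCoeff n ν g := by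
  rw [schurCoeff_apply, hfg, ← schurCoeff_apply]

theorem schurCoeff_sGl [Decidable (ν = μ)] (hν : ν.colLen 0 ≤ n) (hμ : μ.colLen 0 ≤ n) :
    schurCoeff n ν (sGl μ) = if ν = μ then 1 else 0 := by
  rw [schurCoeff_apply, vandermonde_mul_toVars_sGl hμ, tupleCoeff_shiftedRows_alternant hν hμ]

theorem schurCoeff_sum_sGl {s : Finset YoungDiagram} [Decidable (ν ∈ s)] (hν : ν.colLen 0 ≤ n)
    (hs : ∀ μ ∈ s, μ.colLen 0 ≤ n) (c : YoungDiagram → ℤ) :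
    schurCoeff n ν (∑ μ ∈ s, c μ • sGl μ) = if ν ∈ s then c ν else 0 := by
  classical
  have h_term : ∀ μ ∈ s, schurCoeff n ν (c μ • sGl μ) = if ν = μ then c μ else 0 := by
    intro μ hμ
    rw [map_zsmul, schurCoeff_sGl hν (hs μ hμ), smul_eq_mul, mul_ite, mul_one, mul_zero]
  rw [map_sum, Finset.sum_congr rfl h_term, Finset.sum_ite_eq]
  congr

theorem linearCombination_sGl_injective :
    Function.Injective fun c : YoungDiagram →₀ ℤ => Finsupp.linearCombination ℤ sGl c := by
  classical
  refine (injective_iff_map_eq_zero (Finsupp.linearCombination ℤ sGl)).2 fun c hc => ?_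
  ext μ
  let n := (insert μ c.support).sup fun ν => ν.colLen 0
  have h_le : ∀ ν ∈ insert μ c.support, ν.colLen 0 ≤ n := fun ν hν =>
    Finset.le_sup (f := fun ν : YoungDiagram => ν.colLen 0) hν
  have h_coeff := congrArg (schurCoeff n μ) hc
  rw [Finsupp.linearCombination_apply, Finsupp.sum, map_zero, schurCoeff_sum_sGl
    (h_le μ (Finset.mem_insert_self _ _)) fun ν hν => h_le ν (Finset.mem_insert_of_mem hν)]
    at h_coeff
  simpa using h_coeff

theorem toVars_sGl_mul_sGl (hn : μ.card + γ.card ≤ n) :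
    toVars n (sGl μ * sGl γ) = toVars n
      (∑ ν ∈ parts (μ.card + γ.card), schurCoeff n ν (sGl μ * sGl γ) • sGl ν) := by
  have hμ : μ.colLen 0 ≤ n := (colLen_zero_le_card μ).trans (by omega)
  have hγ : γ.colLen 0 ≤ n := (colLen_zero_le_card γ).trans (by omega)
  have h_left : vandermonde MvPowerSeries.X * toVars n (sGl μ * sGl γ) =
      alternant MvPowerSeries.X (shiftedRows n μ) * schur MvPowerSeries.X (rowTuple n γ) := by
    rw [map_mul, ← mul_assoc, vandermonde_mul_toVars_sGl hμ, toVars_sGl hγ]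
  refine mul_left_cancel₀ vandermonde_X_ne_zero ?_
  calc vandermonde MvPowerSeries.X * toVars n (sGl μ * sGl γ)
      = ∑ ν ∈ parts (μ.card + γ.card), schurCoeff n ν (sGl μ * sGl γ) •
          alternant MvPowerSeries.X (shiftedRows n ν) := by
        simp only [schurCoeff_apply, h_left]
        exact (homogeneousComponent_alternant_mul_schur hμ hγ).symm.trans
          ((isAlternating_alternant_X_mul_schur _ _).homogeneousComponent_eq_sum hn)
    _ = _ := by
        rw [map_sum, Finset.mul_sum]
        refine Finset.sum_congr rfl fun ν hν => ?_
        rw [map_zsmul, mul_smul_comm,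
          vandermonde_mul_toVars_sGl (colLen_zero_le_of_mem_parts hn hν)]

theorem toVars_eq_of_le {d : ℕ} (hdn : d ≤ n) {f g : Lam} (hfg : toVars n f = toVars n g) :
    toVars d f = toVars d g := by
  rw [← sub_eq_zero, ← map_sub] at hfg ⊢
  exact restrictVars_eq_zero_of_le (f := (f - g).1) hdn hfg

theorem eq_of_forall_toVars_eq {f g : Lam} (N : ℕ) (hfg : ∀ n ≥ N, toVars n f = toVars n g) :
    f = g := by
  rw [← sub_eq_zero, ← ZeroMemClass.coe_eq_zero]
  refine eq_zero_of_forall_restrictVars_eq_zero N fun n hn => ?_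
  change toVars n (f - g) = 0
  rw [map_sub, hfg n hn, sub_self]

theorem sGl_mul_sGl_eq_sum_schurCoeff (μ γ : YoungDiagram) :
    sGl μ * sGl γ = ∑ ν ∈ parts (μ.card + γ.card),
      schurCoeff (μ.card + γ.card) ν (sGl μ * sGl γ) • sGl ν := by
  classical
  refine eq_of_forall_toVars_eq (μ.card + γ.card) fun n hn => ?_
  rw [toVars_sGl_mul_sGl hn]
  congr 1
  refine Finset.sum_congr rfl fun ν hν => ?_
  rw [schurCoeff_congr (toVars_eq_of_le hn (toVars_sGl_mul_sGl hn)), schurCoeff_sum_sGl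
    (colLen_zero_le_of_mem_parts le_rfl hν) fun ρ hρ => colLen_zero_le_of_mem_parts le_rfl hρ,
    if_pos hν]

open scoped Classical in
theorem lrCoeff_eq_ite (μ γ ν : YoungDiagram) :
    lrCoeff μ γ ν = if ν ∈ parts (μ.card + γ.card) then
      schurCoeff (μ.card + γ.card) ν (sGl μ * sGl γ) else 0 := by
  let c : YoungDiagram →₀ ℤ := ∑ ν ∈ parts (μ.card + γ.card),
    Finsupp.single ν (schurCoeff (μ.card + γ.card) ν (sGl μ * sGl γ))
  have h_combination : Finsupp.linearCombination ℤ sGl c = sGl μ * sGl γ := by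
    rw [map_sum]
    simp only [Finsupp.linearCombination_single]
    exact (sGl_mul_sGl_eq_sum_schurCoeff μ γ).symm
  rw [lrCoeff, ← h_combination,
    Function.leftInverse_invFun linearCombination_sGl_injective c, Finsupp.finsetSum_apply]
  simp only [Finsupp.single_apply, Finset.sum_ite_eq', h_combination]

theorem card_eq_of_lrCoeff_ne_zero (h : lrCoeff μ γ ν ≠ 0) : ν.card = μ.card + γ.card := by
  classical
  rw [lrCoeff_eq_ite] at h
  exact mem_parts.1 (ite_ne_right_iff.1 h).1

theorem sGl_mul_sGl_eq_sum_lrCoeff (μ γ : YoungDiagram) :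
    sGl μ * sGl γ = ∑ ν ∈ parts (μ.card + γ.card), lrCoeff μ γ ν • sGl ν := by
  classical
  refine (sGl_mul_sGl_eq_sum_schurCoeff μ γ).trans (Finset.sum_congr rfl fun ν hν => ?_)
  rw [lrCoeff_eq_ite, if_pos hν]

theorem schurCoeff_sGl_mul_sGl (hn : μ.card + γ.card ≤ n) (hν : ν.colLen 0 ≤ n) :
    schurCoeff n ν (sGl μ * sGl γ) = lrCoeff μ γ ν := by
  classical
  rw [sGl_mul_sGl_eq_sum_lrCoeff, schurCoeff_sum_sGl hν fun ρ hρ =>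
    colLen_zero_le_of_mem_parts hn hρ]
  exact ite_eq_left_iff.2 fun h => not_imp_comm.1 card_eq_of_lrCoeff_ne_zero
    (fun h_card => h (mem_parts.2 h_card)) |>.symm

theorem tupleCoeff_map {R S σ : Type*} [CommSemiring R] [CommSemiring S] [Fintype σ]
    (φ : R →+* S) (α : σ → ℕ) (f : MvPowerSeries σ R) :
    tupleCoeff α (MvPowerSeries.map φ f) = φ (tupleCoeff α f) :=
  MvPowerSeries.coeff_map _ _ _

theorem tupleCoeff_alternant_mul_schur {R : Type*} [CommRing R] (hn : μ.card + γ.card ≤ n)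
    (hν : ν.colLen 0 ≤ n) :
    tupleCoeff (shiftedRows n ν)
        (alternant MvPowerSeries.X (shiftedRows n μ) * schur MvPowerSeries.X (rowTuple n γ) :
          MvPowerSeries (Fin n) R) = lrCoeff μ γ ν := by
  have hμ : μ.colLen 0 ≤ n := (colLen_zero_le_card μ).trans (by omega)
  have hγ : γ.colLen 0 ≤ n := (colLen_zero_le_card γ).trans (by omega)
  rw [← schurCoeff_sGl_mul_sGl hn hν, schurCoeff_apply, ← eq_intCast (Int.castRingHom R),
    ← tupleCoeff_map, map_mul (toVars n), ← mul_assoc, vandermonde_mul_toVars_sGl hμ,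
    toVars_sGl hγ, map_mul (MvPowerSeries.map _), map_alternant, map_schur]
  simp only [MvPowerSeries.map_X]

end LittlewoodRichardson

/-! ### Branching -/

section BranchingRule

variable {R : Type*} [CommRing R] [IsDomain R] [CharZero R] {n a : ℕ}
  {F K : MvPowerSeries (Fin n) R} {S : Set (Fin n → ℕ)} {Q : Set YoungDiagram}

open scoped Classical in
theorem homogeneousComponent_eq_sum_antidiagonal
    (hFK : IsAlternating (F * K))
    (hK : homogeneousSeries K * alternantSeries MvPowerSeries.X S =
      PowerSeries.C (vandermonde MvPowerSeries.X))
    (hS : ∀ f ∈ S, Antitone f)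
    (hQ : ∀ μ : YoungDiagram, μ.colLen 0 ≤ n → (μ ∈ Q ↔ rowTuple n μ ∈ S)) (ha : a ≤ n) :
    MvPowerSeries.homogeneousComponent (a + ∑ i, staircase n i) F =
      ∑ p ∈ Finset.HasAntidiagonal.antidiagonal a,
        (∑ μ ∈ parts p.1,
          tupleCoeff (shiftedRows n μ) (F * K) • alternant MvPowerSeries.X (shiftedRows n μ)) *
            ∑ γ ∈ parts p.2 with γ ∈ Q, schur MvPowerSeries.X (rowTuple n γ) := by
  have h_series : homogeneousSeries F * PowerSeries.C (vandermonde MvPowerSeries.X) =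
      (PowerSeries.mk fun b =>
        MvPowerSeries.homogeneousComponent (b + ∑ i, staircase n i) (F * K)) *
          alternantSeries MvPowerSeries.X S * PowerSeries.X ^ ∑ i, staircase n i := by
    rw [← hK, ← mul_assoc, ← map_mul, hFK.homogeneousSeries_eq, mul_right_comm]
  refine mul_right_cancel₀ vandermonde_X_ne_zero ?_
  rw [← coeff_homogeneousSeries, ← PowerSeries.coeff_mul_C, h_series, PowerSeries.coeff_mul_X_pow,
    PowerSeries.coeff_mul, Finset.sum_mul]
  refine Finset.sum_congr rfl fun p hp => ?_
  rw [Finset.HasAntidiagonal.mem_antidiagonal] at hp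
  rw [PowerSeries.coeff_mk, hFK.homogeneousComponent_eq_sum (by omega),
    coeff_alternantSeries_eq_vandermonde_mul_sum_schur _ (by omega) hS hQ, mul_assoc,
    mul_comm (vandermonde _)]

open scoped Classical in
/-- Expanding `F = F K · K⁻¹`: the factor `F K` is a combination of alternants, and `K⁻¹` is the
sum of the Schur polynomials of the partitions in `Q`. -/
theorem tupleCoeff_eq_sum_lrCoeff (hFK : IsAlternating (F * K))
    (hK : homogeneousSeries K * alternantSeries MvPowerSeries.X S =
      PowerSeries.C (vandermonde MvPowerSeries.X))
    (hS : ∀ f ∈ S, Antitone f)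
    (hQ : ∀ μ : YoungDiagram, μ.colLen 0 ≤ n → (μ ∈ Q ↔ rowTuple n μ ∈ S))
    {ν : YoungDiagram} (hν : ν.card ≤ n) {s : YoungDiagram → R}
    (hs : ∀ μ : YoungDiagram, μ.colLen 0 ≤ n → tupleCoeff (shiftedRows n μ) (F * K) = s μ) :
    tupleCoeff (shiftedRows n ν) F =
      ∑ p ∈ Finset.HasAntidiagonal.antidiagonal ν.card, ∑ μ ∈ parts p.1,
        ∑ γ ∈ parts p.2 with γ ∈ Q, lrCoeff μ γ ν • s μ := by
  have hνn : ν.colLen 0 ≤ n := (colLen_zero_le_card ν).trans hν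
  have h_component : tupleCoeff (shiftedRows n ν)
      (MvPowerSeries.homogeneousComponent (ν.card + ∑ i, staircase n i) F) =
        tupleCoeff (shiftedRows n ν) F := by
    rw [tupleCoeff_homogeneousComponent, if_pos (sum_shiftedRows hνn)]
  rw [← h_component, homogeneousComponent_eq_sum_antidiagonal hFK hK hS hQ hν, map_sum]
  refine Finset.sum_congr rfl fun p hp => ?_
  rw [Finset.HasAntidiagonal.mem_antidiagonal] at hp
  rw [Finset.sum_mul_sum, map_sum]
  refine Finset.sum_congr rfl fun μ hμ => ?_
  rw [map_sum]
  refine Finset.sum_congr rfl fun γ hγ => ?_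
  rw [mem_parts] at hμ
  rw [Finset.mem_filter, mem_parts] at hγ
  rw [smul_mul_assoc, map_smul, tupleCoeff_alternant_mul_schur (by omega) hνn,
    hs μ ((colLen_zero_le_card μ).trans (by omega)), smul_eq_mul, zsmul_eq_mul, mul_comm]

end BranchingRule

section GeneratingFunctions

instance : IsDomain Lam := by
  have : IsDomain (MvPowerSeries ℕ ℤ) := NoZeroDivisors.to_isDomain _
  infer_instance

instance : CharZero Lam where
  cast_injective a b hab := by
    have h_const :=
      congrArg (fun f : Lam => MvPowerSeries.constantCoeff (f : MvPowerSeries ℕ ℤ)) hab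
    simpa using h_const

variable {n : ℕ} {μ : YoungDiagram}

/-- The generating series `∑ h_r z^r` of the complete homogeneous symmetric functions. -/
noncomputable def hSeries : PowerSeries Lam := PowerSeries.mk fun r => h r

theorem coeff_X_pow_mul_hSeries (a e : ℕ) :
    PowerSeries.coeff a (PowerSeries.X ^ e * hSeries) = h ((a : ℤ) - e) := by
  rw [PowerSeries.coeff_X_pow_mul']
  split_ifs with hea
  · rw [hSeries, PowerSeries.coeff_mk, Nat.cast_sub hea]
  · rw [h_of_neg (by omega)]

theorem det_inVar_mul_hSeries (u : Fin n → PowerSeries Lam) :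
    Matrix.det (Matrix.of fun i j => inVar i (u j * hSeries)) =
      Matrix.det (Matrix.of fun i j => inVar i (u j)) * ∏ i, inVar i hSeries := by
  rw [mul_comm, ← Matrix.det_mul_column]
  simp only [map_mul, Matrix.of_apply, mul_comm]

theorem shiftedRows_sub_staircase (μ : YoungDiagram) (i j : Fin n) :
    (shiftedRows n μ i : ℤ) - staircase n j = (μ.rowLen i : ℤ) - i + j := by
  have := i.is_lt
  have := j.is_lt
  rw [shiftedRows, rowTuple, staircase_apply, staircase_apply]
  omega

/-- The generating function `∏_{i < j} (t_i - t_j) ∏_i ∑_r h_r t_i^r` of the Schur functions: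
`sGl μ` is the coefficient at the exponents `shiftedRows n μ`. -/
noncomputable def glSeries (n : ℕ) : MvPowerSeries (Fin n) Lam :=
  vandermonde MvPowerSeries.X * ∏ i, inVar i hSeries

theorem glSeries_eq_det : glSeries n =
    Matrix.det (Matrix.of fun i j : Fin n =>
      inVar i (PowerSeries.X ^ staircase n j * hSeries)) := by
  rw [det_inVar_mul_hSeries, ← alternant_X_eq_det_inVar]
  rfl

theorem tupleCoeff_glSeries (hμ : μ.colLen 0 ≤ n) :
    tupleCoeff (shiftedRows n μ) (glSeries n) = sGl μ := by
  rw [glSeries_eq_det, tupleCoeff_det_inVar, sGl_eq_det hμ]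
  simp only [coeff_X_pow_mul_hSeries, shiftedRows_sub_staircase]

theorem glSeries_mul_so_kernel_eq_det :
    glSeries n * (pairKernel 1 MvPowerSeries.X * diagKernel 1 MvPowerSeries.X) =
      Matrix.det (Matrix.of fun i j : Fin n => inVar i ((PowerSeries.X ^ staircase n j -
        PowerSeries.X ^ (staircase n j + 2 * (j : ℕ) + 2)) * hSeries)) := by
  rw [det_inVar_mul_hSeries, glSeries, mul_right_comm, ← det_so_denominator]
  simp only [map_sub, map_pow, inVar_X]

theorem tupleCoeff_glSeries_mul_so_kernel (hμ : μ.colLen 0 ≤ n) :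
    tupleCoeff (shiftedRows n μ)
      (glSeries n * (pairKernel 1 MvPowerSeries.X * diagKernel 1 MvPowerSeries.X)) = sSo μ := by
  rw [glSeries_mul_so_kernel_eq_det, tupleCoeff_det_inVar, sSo_eq_det hμ]
  congr 1
  ext1 i j
  rw [Matrix.of_apply, Matrix.of_apply, sub_mul, map_sub, coeff_X_pow_mul_hSeries,
    coeff_X_pow_mul_hSeries, shiftedRows_sub_staircase]
  congr 2
  have := shiftedRows_sub_staircase μ i j
  push_cast
  omega

theorem glSeries_mul_sp_kernel_eq_det :
    glSeries n * pairKernel 1 MvPowerSeries.X =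
      Matrix.det (Matrix.of fun i j : Fin n => inVar i ((if (j : ℕ) = 0 then
        PowerSeries.X ^ staircase n j else PowerSeries.X ^ staircase n j +
          PowerSeries.X ^ (staircase n j + 2 * (j : ℕ))) * hSeries)) := by
  rw [det_inVar_mul_hSeries, glSeries, mul_right_comm, ← det_sp_denominator]
  simp only [apply_ite (inVar _), map_add, map_pow, inVar_X]

theorem tupleCoeff_glSeries_mul_sp_kernel (hμ : μ.colLen 0 ≤ n) :
    tupleCoeff (shiftedRows n μ) (glSeries n * pairKernel 1 MvPowerSeries.X) = sSp μ := by
  rw [glSeries_mul_sp_kernel_eq_det, tupleCoeff_det_inVar, sSp_eq_det hμ]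
  congr 1
  ext1 i j
  rw [Matrix.of_apply, Matrix.of_apply]
  have h_exponent := shiftedRows_sub_staircase μ i j
  split_ifs with hj
  · rw [coeff_X_pow_mul_hSeries, h_exponent, hj, Nat.cast_zero, add_zero]
  · rw [add_mul, map_add, coeff_X_pow_mul_hSeries, coeff_X_pow_mul_hSeries, h_exponent]
    congr 2
    push_cast
    omega

open scoped Classical in
theorem sGl_eq_sum_sSo (ν : YoungDiagram) :
    sGl ν = ∑ p ∈ Finset.HasAntidiagonal.antidiagonal ν.card, ∑ μ ∈ parts p.1,
      ∑ γ ∈ parts p.2 with γ ∈ evenRows, lrCoeff μ γ ν • sSo μ := by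
  rw [← tupleCoeff_glSeries (colLen_zero_le_card ν)]
  refine tupleCoeff_eq_sum_lrCoeff ?_ ?_ (fun f hf => hf.1) (fun μ hμ => mem_evenRows_iff hμ)
    le_rfl fun μ hμ => tupleCoeff_glSeries_mul_so_kernel hμ
  · rw [glSeries_mul_so_kernel_eq_det]
    exact isAlternating_det_inVar _
  · rw [map_mul, homogeneousSeries_pairKernel, homogeneousSeries_diagKernel,
      pairKernel_mul_diagKernel_mul_alternantSeries]

open scoped Classical in
theorem sGl_eq_sum_sSp (ν : YoungDiagram) :
    sGl ν = ∑ p ∈ Finset.HasAntidiagonal.antidiagonal ν.card, ∑ μ ∈ parts p.1,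
      ∑ γ ∈ parts p.2 with γ ∈ evenCols, lrCoeff μ γ ν • sSp μ := by
  rw [← tupleCoeff_glSeries (colLen_zero_le_card ν)]
  refine tupleCoeff_eq_sum_lrCoeff ?_ ?_ (fun f hf => hf.1) (fun μ hμ => mem_evenCols_iff hμ)
    le_rfl fun μ hμ => tupleCoeff_glSeries_mul_sp_kernel hμ
  · rw [glSeries_mul_sp_kernel_eq_det]
    exact isAlternating_det_inVar _
  · rw [homogeneousSeries_pairKernel, pairKernel_mul_alternantSeries]

end GeneratingFunctions

/-! ### Infinite products -/

section Products

open scoped Classical in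
theorem coeff_eq_sum_schur {n k : ℕ} {R : Type*} [CommRing R] [IsDomain R]
    {D E : PowerSeries (MvPowerSeries (Fin n) R)} (hED : E * D = 1)
    {S : Set (Fin n → ℕ)} (hS : ∀ f ∈ S, Antitone f)
    (hD : PowerSeries.expand 2 two_ne_zero D * alternantSeries MvPowerSeries.X S =
      PowerSeries.C (vandermonde MvPowerSeries.X)) {Q : Set YoungDiagram}
    (hQ : ∀ μ : YoungDiagram, μ.colLen 0 ≤ n → (μ ∈ Q ↔ rowTuple n μ ∈ S)) (hk : 2 * k ≤ n) :
    PowerSeries.coeff k E =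
      ∑ ν ∈ parts (2 * k) with ν ∈ Q, schur MvPowerSeries.X (rowTuple n ν) := by
  have h_series : alternantSeries MvPowerSeries.X S =
      PowerSeries.C (vandermonde MvPowerSeries.X) * PowerSeries.expand 2 two_ne_zero E := by
    rw [← hD, mul_right_comm, ← map_mul, mul_comm D, hED, map_one, one_mul]
  refine mul_left_cancel₀ vandermonde_X_ne_zero ?_
  rw [← coeff_alternantSeries_eq_vandermonde_mul_sum_schur _ hk hS hQ, h_series,
    PowerSeries.coeff_C_mul, PowerSeries.coeff_expand_mul]

theorem hasProd_of_restrictVars_eq {R ι : Type*} [CommRing R] [TopologicalSpace R]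
    {f : ι → PowerSeries (MvPowerSeries ℕ R)} {F : PowerSeries (MvPowerSeries ℕ R)}
    (h : ∀ k, ∃ N, ∀ n ≥ N, ∃ s₀ : Finset ι, ∀ s ≥ s₀,
      restrictVars n (PowerSeries.coeff k (∏ p ∈ s, f p)) =
        restrictVars n (PowerSeries.coeff k F)) : HasProd f F := by
  rw [HasProd, PowerSeries.WithPiTopology.tendsto_iff_coeff_tendsto]
  intro k
  rw [MvPowerSeries.WithPiTopology.tendsto_iff_coeff_tendsto]
  intro m
  obtain ⟨N, hN⟩ := h k
  obtain ⟨n, hn, m, rfl⟩ := exists_embDomain_eq N m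
  obtain ⟨s₀, hs₀⟩ := hN n hn
  refine tendsto_nhds_of_eventually_eq ?_
  rw [SummationFilter.unconditional_filter]
  filter_upwards [Filter.eventually_ge_atTop s₀] with s hs
  rw [← coeff_restrictVars, hs₀ s hs, coeff_restrictVars]

theorem factor_mul_one_sub (i j : ℕ) : factor i j *
    (1 - PowerSeries.X * PowerSeries.C (MvPowerSeries.X i * MvPowerSeries.X j)) = 1 := by
  rw [mul_comm]
  exact PowerSeries.mul_invOfUnit _ _ (by simp)

variable (r : ℕ → ℕ → Prop) [DecidableRel r]

/-- The pairs of indices below `n` that satisfy the relation `r`. -/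
def relPairs (n : ℕ) : Finset {p : ℕ × ℕ // r p.1 p.2} :=
  (Finset.range n ×ˢ Finset.range n).subtype fun p => r p.1 p.2

theorem prod_relPairs {B : Type*} [CommMonoid B] (g : ℕ → ℕ → B) (n : ℕ) :
    ∏ p ∈ relPairs r n, g p.1.1 p.1.2 =
      ∏ i : Fin n, ∏ j ∈ ({j | r i j} : Finset (Fin n)), g i j := by
  rw [relPairs, Finset.prod_subtype_eq_prod_filter (f := fun p : ℕ × ℕ => g p.1 p.2),
    Finset.prod_filter, Finset.prod_product, ← Fin.prod_univ_eq_prod_range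
      (fun i => ∏ j ∈ Finset.range n, if r i j then g i j else 1)]
  refine Finset.prod_congr rfl fun i _ => ?_
  rw [Finset.prod_filter, ← Fin.prod_univ_eq_prod_range (fun j => if r i j then g i j else 1)]

theorem map_prod_factor_mul_kernel {n : ℕ} {s : Finset {p : ℕ × ℕ // r p.1 p.2}}
    (hs : relPairs r n ⊆ s) :
    PowerSeries.map (restrictVars n) (∏ p ∈ s, factor p.1.1 p.1.2) *
      ∏ i : Fin n, ∏ j ∈ ({j | r i j} : Finset (Fin n)), (1 - PowerSeries.X *
        (PowerSeries.C (MvPowerSeries.X i : MvPowerSeries (Fin n) ℤ) *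
          PowerSeries.C (MvPowerSeries.X j))) = 1 := by
  let g : ℕ → ℕ → PowerSeries (MvPowerSeries (Fin n) ℤ) := fun i j =>
    PowerSeries.map (restrictVars n)
      (1 - PowerSeries.X * PowerSeries.C (MvPowerSeries.X i * MvPowerSeries.X j))
  have hg (i j : ℕ) : g i j = 1 - PowerSeries.X *
      (PowerSeries.C (restrictVars n (MvPowerSeries.X i)) *
        PowerSeries.C (restrictVars n (MvPowerSeries.X j))) := by
    simp only [g, map_sub, map_one, map_mul, PowerSeries.map_X, PowerSeries.map_C]
  have h_subset : ∏ p ∈ relPairs r n, g p.1.1 p.1.2 = ∏ p ∈ s, g p.1.1 p.1.2 := by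
    refine Finset.prod_subset hs fun p _ hp => ?_
    rw [relPairs, Finset.mem_subtype, Finset.mem_product, Finset.mem_range, Finset.mem_range,
      not_and_or, not_lt, not_lt] at hp
    rw [hg]
    obtain hp | hp := hp <;> simp [restrictVars_X_of_le hp]
  rw [prod_relPairs] at h_subset
  simp only [hg, restrictVars_X] at h_subset
  rw [h_subset, map_prod, ← Finset.prod_mul_distrib]
  refine Finset.prod_eq_one fun p _ => ?_
  rw [← hg, ← map_mul, factor_mul_one_sub, map_one]

open scoped Classical in
theorem hasProd_factor {F : PowerSeries Lam} {Q : Set YoungDiagram}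
    {S : ∀ n, Set (Fin n → ℕ)}
    (hF : ∀ k, PowerSeries.coeff k F = ∑ ν ∈ parts (2 * k) with ν ∈ Q, sGl ν)
    (hS : ∀ n, ∀ f ∈ S n, Antitone f)
    (hQ : ∀ n, ∀ μ : YoungDiagram, μ.colLen 0 ≤ n → (μ ∈ Q ↔ rowTuple n μ ∈ S n))
    (hD : ∀ n, PowerSeries.expand 2 two_ne_zero
      (∏ i : Fin n, ∏ j ∈ ({j | r i j} : Finset (Fin n)), (1 - PowerSeries.X *
        (PowerSeries.C (MvPowerSeries.X i : MvPowerSeries (Fin n) ℤ) *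
          PowerSeries.C (MvPowerSeries.X j)))) * alternantSeries MvPowerSeries.X (S n) =
            PowerSeries.C (vandermonde MvPowerSeries.X)) :
    HasProd (fun p : {p : ℕ × ℕ // r p.1 p.2} => factor p.1.1 p.1.2)
      (PowerSeries.map Lam.subtype F) := by
  refine hasProd_of_restrictVars_eq fun k => ⟨2 * k, fun n hn => ⟨relPairs r n, fun s hs => ?_⟩⟩
  have h_toVars : toVars n (PowerSeries.coeff k F) =
      ∑ ν ∈ parts (2 * k) with ν ∈ Q, schur MvPowerSeries.X (rowTuple n ν) := by
    rw [hF, map_sum]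
    exact Finset.sum_congr rfl fun ν hν =>
      toVars_sGl (colLen_zero_le_of_mem_parts hn (Finset.mem_filter.1 hν).1)
  rw [← PowerSeries.coeff_map,
    coeff_eq_sum_schur (map_prod_factor_mul_kernel r hs) (hS n) (hD n) (hQ n) hn]
  exact h_toVars.symm

end Products

section Kernels

variable {A : Type*} [CommRing A] {n : ℕ} (q : A) (t : Fin n → A)

theorem prod_lt_eq_pairKernel :
    ∏ i : Fin n, ∏ j ∈ ({j | (i : ℕ) < j} : Finset (Fin n)), (1 - q * (t i * t j)) =
      pairKernel q t := by
  simp only [Fin.val_fin_lt, Finset.filter_lt_eq_Ioi]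
  rfl

theorem prod_le_eq_pairKernel_mul_diagKernel :
    ∏ i : Fin n, ∏ j ∈ ({j | (i : ℕ) ≤ j} : Finset (Fin n)), (1 - q * (t i * t j)) =
      pairKernel q t * diagKernel q t := by
  simp only [Fin.val_fin_le, Finset.filter_le_eq_Ici, ← Finset.mul_prod_Ioi_eq_prod_Ici]
  rw [Finset.prod_mul_distrib, mul_comm]
  rfl

theorem expand_pairKernel :
    PowerSeries.expand 2 two_ne_zero (pairKernel PowerSeries.X fun i => PowerSeries.C (t i)) =
      pairKernel (PowerSeries.X ^ 2) fun i => PowerSeries.C (t i) := by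
  refine (map_pairKernel (PowerSeries.expand (R := A) 2 two_ne_zero).toRingHom _ _).trans ?_
  simp only [AlgHom.toRingHom_eq_coe, RingHom.coe_coe, PowerSeries.expand_X,
    PowerSeries.expand_C]

theorem expand_diagKernel :
    PowerSeries.expand 2 two_ne_zero (diagKernel PowerSeries.X fun i => PowerSeries.C (t i)) =
      diagKernel (PowerSeries.X ^ 2) fun i => PowerSeries.C (t i) := by
  refine (map_diagKernel (PowerSeries.expand (R := A) 2 two_ne_zero).toRingHom _ _).trans ?_
  simp only [AlgHom.toRingHom_eq_coe, RingHom.coe_coe, PowerSeries.expand_X,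
    PowerSeries.expand_C]

end Kernels

/-! ### Multiplicities -/

section Multiplicities

/-- The partitions of size at most `n`: those that can occur in a Littlewood–Richardson
coefficient of degree `n`. -/
noncomputable def smallParts (n : ℕ) : Finset YoungDiagram :=
  open scoped Classical in (Finset.range (n + 1)).biUnion parts

theorem mem_smallParts {n : ℕ} {μ : YoungDiagram} : μ ∈ smallParts n ↔ μ.card ≤ n := by
  simp [smallParts, mem_parts]

open scoped Classical in
theorem sum_antidiagonal_parts {B : Type*} [AddCommMonoid B] {n : ℕ} (Q : Set YoungDiagram)
    {g : YoungDiagram → YoungDiagram → B} (hg : ∀ μ γ, g μ γ ≠ 0 → μ.card + γ.card = n) :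
    ∑ p ∈ Finset.HasAntidiagonal.antidiagonal n, ∑ μ ∈ parts p.1, ∑ γ ∈ parts p.2 with γ ∈ Q,
      g μ γ = ∑ μ ∈ smallParts n, ∑ γ ∈ smallParts n with γ ∈ Q, g μ γ := by
  rw [← Finset.sum_product', ← Finset.sum_filter_of_ne
    (p := fun x : YoungDiagram × YoungDiagram => x.1.card + x.2.card = n) fun x _ h => hg _ _ h,
    ← Finset.sum_fiberwise_of_maps_to (t := Finset.HasAntidiagonal.antidiagonal n)
      (g := fun x : YoungDiagram × YoungDiagram => (x.1.card, x.2.card))]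
  · refine Finset.sum_congr rfl fun p hp => ?_
    rw [Finset.HasAntidiagonal.mem_antidiagonal] at hp
    rw [← Finset.sum_product']
    refine Finset.sum_congr ?_ fun _ _ => rfl
    ext ⟨μ, γ⟩
    simp only [Finset.mem_product, Finset.mem_filter, mem_parts, mem_smallParts, Prod.ext_iff]
    constructor
    · rintro ⟨hμ, hγ, hQ⟩
      exact ⟨⟨⟨by omega, by omega, hQ⟩, by omega⟩, hμ, hγ⟩
    · rintro ⟨⟨⟨-, -, hQ⟩, -⟩, hμ, hγ⟩
      exact ⟨hμ, hγ, hQ⟩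
  · intro x hx
    exact Finset.HasAntidiagonal.mem_antidiagonal.2 (Finset.mem_filter.1 hx).2

theorem finite_lrCoeff (Q Q' : Set YoungDiagram) (k : ℕ) :
    {t : YoungDiagram × YoungDiagram × YoungDiagram |
      t.2.1 ∈ Q ∧ t.2.1.card = k ∧ t.2.2 ∈ Q' ∧ lrCoeff t.1 t.2.2 t.2.1 ≠ 0}.Finite := by
  refine (smallParts k ×ˢ smallParts k ×ˢ smallParts k).finite_toSet.subset ?_
  rintro ⟨μ, ν, γ⟩ ⟨-, hν : ν.card = k, -, h_ne : lrCoeff μ γ ν ≠ 0⟩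
  have h_card := card_eq_of_lrCoeff_ne_zero h_ne
  simp only [Finset.mem_coe, Finset.mem_product, mem_smallParts]
  omega

open scoped Classical in
theorem finsum_lrCoeff (Q Q' : Set YoungDiagram) (k : ℕ) (μ : YoungDiagram) :
    ∑ᶠ ν ∈ {ν : YoungDiagram | ν ∈ Q ∧ ν.card = k}, ∑ᶠ γ ∈ Q', lrCoeff μ γ ν =
      ∑ ν ∈ parts k with ν ∈ Q, ∑ γ ∈ smallParts k with γ ∈ Q', lrCoeff μ γ ν := by
  have h_coe : {ν : YoungDiagram | ν ∈ Q ∧ ν.card = k} =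
      ((parts k).filter (· ∈ Q) : Finset YoungDiagram) := by
    ext ν
    simp [mem_parts, and_comm]
  rw [h_coe, finsum_mem_coe_finset]
  refine Finset.sum_congr rfl fun ν hν => finsum_mem_eq_sum_of_inter_support_eq _ ?_
  rw [Finset.mem_filter, mem_parts] at hν
  ext γ
  simp only [Set.mem_inter_iff, Function.mem_support, Finset.coe_filter, mem_smallParts]
  refine and_congr_left fun h_ne => ⟨fun hγ => ⟨?_, hγ⟩, fun hγ => hγ.2⟩
  have h_card := card_eq_of_lrCoeff_ne_zero h_ne
  omega

theorem card_le_of_finsum_lrCoeff_ne_zero {Q Q' : Set YoungDiagram} {k : ℕ} {μ : YoungDiagram}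
    (h : ∑ᶠ ν ∈ {ν : YoungDiagram | ν ∈ Q ∧ ν.card = k}, ∑ᶠ γ ∈ Q', lrCoeff μ γ ν ≠ 0) :
    μ.card ≤ k := by
  obtain ⟨ν, hν, h⟩ := exists_ne_zero_of_finsum_mem_ne_zero h
  obtain ⟨γ, -, h⟩ := exists_ne_zero_of_finsum_mem_ne_zero h
  have h_card := card_eq_of_lrCoeff_ne_zero h
  exact hν.2 ▸ h_card ▸ Nat.le_add_right _ _

open scoped Classical in
theorem finsum_smul_eq_sum_sGl {s : YoungDiagram → Lam} {Q' : Set YoungDiagram}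
    (hs : ∀ ν, sGl ν = ∑ p ∈ Finset.HasAntidiagonal.antidiagonal ν.card, ∑ μ ∈ parts p.1,
      ∑ γ ∈ parts p.2 with γ ∈ Q', lrCoeff μ γ ν • s μ) (Q : Set YoungDiagram) (k : ℕ) :
    ∑ᶠ μ : YoungDiagram, (∑ᶠ ν ∈ {ν : YoungDiagram | ν ∈ Q ∧ ν.card = k},
      ∑ᶠ γ ∈ Q', lrCoeff μ γ ν) • s μ = ∑ ν ∈ parts k with ν ∈ Q, sGl ν := by
  have h_support : Function.support (fun μ : YoungDiagram =>
      (∑ᶠ ν ∈ {ν : YoungDiagram | ν ∈ Q ∧ ν.card = k}, ∑ᶠ γ ∈ Q', lrCoeff μ γ ν) • s μ) ⊆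
        smallParts k := fun μ hμ =>
    mem_smallParts.2 (card_le_of_finsum_lrCoeff_ne_zero (left_ne_zero_of_smul hμ))
  rw [finsum_eq_sum_of_support_subset _ h_support]
  simp_rw [finsum_lrCoeff, Finset.sum_smul]
  rw [Finset.sum_comm]
  refine Finset.sum_congr rfl fun ν hν => ?_
  rw [Finset.mem_filter, mem_parts] at hν
  have h_card (μ γ : YoungDiagram) (h : lrCoeff μ γ ν • s μ ≠ 0) : μ.card + γ.card = ν.card :=
    (card_eq_of_lrCoeff_ne_zero (left_ne_zero_of_smul h)).symm
  rw [hs ν, sum_antidiagonal_parts Q' h_card, hν.1]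

theorem isCharSo_mk :
    IsCharSo (PowerSeries.mk fun k => ∑ᶠ μ : YoungDiagram, mSo k μ • sSo μ) := by
  classical
  refine hasProd_factor (· < ·) (Q := evenCols) (S := evenColTuples) (fun k => ?_)
    (fun n f hf => hf.1) (fun n μ hμ => mem_evenCols_iff hμ) fun n => ?_
  · rw [PowerSeries.coeff_mk]
    exact finsum_smul_eq_sum_sGl sGl_eq_sum_sSo evenCols (2 * k)
  · rw [prod_lt_eq_pairKernel PowerSeries.X fun i => PowerSeries.C (MvPowerSeries.X i),
      expand_pairKernel, pairKernel_mul_alternantSeries]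

theorem isCharSp_mk :
    IsCharSp (PowerSeries.mk fun k => ∑ᶠ μ : YoungDiagram, mSp k μ • sSp μ) := by
  classical
  refine hasProd_factor (· ≤ ·) (Q := evenRows) (S := evenRowTuples) (fun k => ?_)
    (fun n f hf => hf.1) (fun n μ hμ => mem_evenRows_iff hμ) fun n => ?_
  · rw [PowerSeries.coeff_mk]
    exact finsum_smul_eq_sum_sGl sGl_eq_sum_sSp evenRows (2 * k)
  · rw [prod_le_eq_pairKernel_mul_diagKernel PowerSeries.X fun i =>
      PowerSeries.C (MvPowerSeries.X i), map_mul, expand_pairKernel, expand_diagKernel,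
      pairKernel_mul_diagKernel_mul_alternantSeries]

end Multiplicities

end UniversalCharacters

theorem mainTheorem10 :
    ((∀ k : ℕ, {t : YoungDiagram × YoungDiagram × YoungDiagram |
        t.2.1 ∈ UniversalCharacters.evenCols ∧ t.2.1.card = 2 * k ∧
        t.2.2 ∈ UniversalCharacters.evenRows ∧
        UniversalCharacters.lrCoeff t.1 t.2.2 t.2.1 ≠ 0}.Finite) ∧
      UniversalCharacters.IsCharSo (PowerSeries.mk fun k =>
        ∑ᶠ μ : YoungDiagram, UniversalCharacters.mSo k μ • UniversalCharacters.sSo μ)) ∧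
    ((∀ k : ℕ, {t : YoungDiagram × YoungDiagram × YoungDiagram |
        t.2.1 ∈ UniversalCharacters.evenRows ∧ t.2.1.card = 2 * k ∧
        t.2.2 ∈ UniversalCharacters.evenCols ∧
        UniversalCharacters.lrCoeff t.1 t.2.2 t.2.1 ≠ 0}.Finite) ∧
      UniversalCharacters.IsCharSp (PowerSeries.mk fun k =>
        ∑ᶠ μ : YoungDiagram, UniversalCharacters.mSp k μ • UniversalCharacters.sSp μ)) := by
  open UniversalCharacters in
  exact ⟨⟨fun k => finite_lrCoeff evenCols evenRows (2 * k), isCharSo_mk⟩,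
    ⟨fun k => finite_lrCoeff evenRows evenCols (2 * k), isCharSp_mk⟩⟩
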